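/- Let $(X_t)_{t\ge 0}$ be an irreducible Markov chain on a finite state space $S$ with transition matrix $P$ and stationary distribution $\pi$. It is reversible if $\pi(x)P(x,y)=\pi(y)P(y,x)$ for all $x,y\in S$. For probability distributions $\mu,\nu$ on $S$ let $\|\mu-\nu\|=\tfrac12\sum_{x}|\mu(x)-\nu(x)|$ be the total variation distance. Let $P_L=\frac{P+I}{2}$ be the transition matrix of the lazy version of the chain, and define its mixing time by $$t_{\mathrm L}=\min\Big\{t\in\{0,1,2,\dots\}:\ \max_{x\in S}\|P_L^t(x,\cdot)-\pi\|\le \tfrac14\Big\}.$$ For $A\subseteq S$ let $\tau_A=\min\{t\ge 0: X_t\in A\}$ be the first hitting time of $A$ by the (non-lazy) chain with transition matrix $P$, and for $\alpha\in(0,1/2)$ let $$t_{\mathrm H}(\alpha)=\max_{x\in S,\ A\subseteq S:\ \pi(A)\ge\alpha}\mathbb E_x[\tau_A].$$ **Theorem.** Let $0<\alpha<1/2$. There exist positive constants $c'_\alpha$ and $c_\alpha$, depending only on $\alpha$, such that for every irreducible reversible Markov chain on a finite state space, $t_{\mathrm L}$ and $t_{\mathrm H}(\alpha)$ are finite and $$c'_\alpha\,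 t_{\mathrm H}(\alpha)\ \le\ t_{\mathrm L}\ \le\ c_\alpha\, t_{\mathrm H}(\alpha).$$ -/

import Mathlib

open MeasureTheory ProbabilityTheory
open scoped ENNReal NNReal

namespace ReversibleMixing

section

variable {V : Type*} [Fintype V] [DecidableEq V]

/-- The total variation distance `½ ∑ₓ |μ(x) - ν(x)|` of two probability vectors. -/
noncomputable def tvDist (μ ν : V → ℝ) : ℝ := (1 / 2) * ∑ x, |μ x - ν x|

/-- The probability vector `π` is stationary for the transition matrix `P`. -/
def IsStationary (P : Matrix V V ℝ) (π : V → ℝ) : Prop :=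
  π ∈ stdSimplex ℝ V ∧ ∀ y, ∑ x, π x * P x y = π y

/-- Reversibility: the detailed balance equations. -/
def IsReversible (P : Matrix V V ℝ) (π : V → ℝ) : Prop :=
  ∀ x y, π x * P x y = π y * P y x

/-- The worst-case distance to stationarity `d(t) = maxₓ ‖Qᵗ(x, ·) - π‖`. -/
noncomputable def distToStationary (Q : Matrix V V ℝ) (π : V → ℝ) (t : ℕ) : ℝ :=
  ⨆ x, tvDist (fun y => (Q ^ t) x y) π

/-- The mixing time `min {t ≥ 0 : d(t) ≤ ε}`, with the value `∞` if there is no such `t`. -/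
noncomputable def mixingTime (Q : Matrix V V ℝ) (π : V → ℝ) (ε : ℝ) : ℝ≥0∞ :=
  ⨅ (t : ℕ) (_ : distToStationary Q π t ≤ ε), (t : ℝ≥0∞)

/-- The transition matrix `(P + I) / 2` of the lazy version of the chain. -/
noncomputable def lazyMatrix (P : Matrix V V ℝ) : Matrix V V ℝ := (1 / 2 : ℝ) • (P + 1)

/-- The mixing time `t_L` of the lazy chain, with `ε = 1/4`. -/
noncomputable def lazyMixingTime (P : Matrix V V ℝ) (π : V → ℝ) : ℝ≥0∞ :=
  mixingTime (lazyMatrix P) π (1 / 4)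

variable [MeasurableSpace V] [DiscreteMeasurableSpace V]

/-- One step of the chain: from `x` it moves to `y` with probability `P x y`. -/
noncomputable def stepKernel (P : Matrix.rowStochastic ℝ V) : Kernel V V where
  toFun x := ∑ y, ENNReal.ofReal ((P : Matrix V V ℝ) x y) • Measure.dirac y
  measurable' := Measurable.of_discrete

instance (P : Matrix.rowStochastic ℝ V) : IsMarkovKernel (stepKernel P) where
  isProbabilityMeasure x := by
    constructor
    have h : stepKernel P x
        = ∑ y, ENNReal.ofReal ((P : Matrix V V ℝ) x y) • Measure.dirac y := rfl
    rw [h]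
    simp only [Measure.coe_finsetSum, Finset.sum_apply, Measure.smul_apply, measure_univ,
      smul_eq_mul, mul_one]
    rw [← ENNReal.ofReal_sum_of_nonneg
      (fun y _ => Matrix.nonneg_of_mem_rowStochastic P.2),
      Matrix.sum_row_of_mem_rowStochastic P.2, ENNReal.ofReal_one]

/-- The law of `X_{n+1}` given `(X_0, …, X_n)`; it depends on `X_n` only. -/
noncomputable def historyKernel (P : Matrix.rowStochastic ℝ V) (n : ℕ) :
    Kernel (Finset.Iic n → V) V :=
  (stepKernel P).comap (fun h => h ⟨n, Finset.mem_Iic.2 le_rfl⟩) (measurable_pi_apply _)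

instance (P : Matrix.rowStochastic ℝ V) (n : ℕ) : IsMarkovKernel (historyKernel P n) :=
  Kernel.IsMarkovKernel.comap _ _

/-- The law `ℙₓ`, on the space of trajectories, of the Markov chain with transition matrix `P`
started at `x`. -/
noncomputable def pathLaw (P : Matrix.rowStochastic ℝ V) (x : V) : Measure (ℕ → V) :=
  Kernel.trajMeasure (X := fun _ => V) (Measure.dirac x) (historyKernel P)

/-- The first hitting time `τ_A = min {t ≥ 0 : X_t ∈ A}`, with the value `∞` if `A` is never
hit. -/
noncomputable def hitTime (A : Set V) (ω : ℕ → V) : ℕ∞ :=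
  hittingAfter (fun (t : ℕ) (ω : ℕ → V) => ω t) A 0 ω

/-- The expected hitting time `𝔼ₓ[τ_A]`. -/
noncomputable def expHitTime (P : Matrix.rowStochastic ℝ V) (x : V) (A : Set V) : ℝ≥0∞ :=
  ∫⁻ ω, (hitTime A ω : ℝ≥0∞) ∂(pathLaw P x)

/-- The maximal expected hitting time `t_H(α)` of sets of stationary measure at least `α`. -/
noncomputable def maxHitTime (P : Matrix.rowStochastic ℝ V) (π : V → ℝ) (α : ℝ) : ℝ≥0∞ :=
  ⨆ (x : V) (A : Finset V) (_ : α ≤ ∑ y ∈ A, π y), expHitTime P x (A : Set V)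

end

end ReversibleMixing

set_option linter.unusedSectionVars false

namespace ReversibleMixing

/-! Expected hitting times of a nonempty set `A` are the unique solution `h` of `h = 0` on `A`, `h =
1 + P h` off `A`. The path measure serves only to establish this (`expHitTime_eq_tsum`,
`IsHittingFunction.expHitTime_eq`); everything else is linear algebra with such functions. Passing
to the lazy matrix `Q` doubles `h`.

Lower bound on the mixing time `t`: deviations from the mean halve every `t` steps, so with `2⁻ᵏ ≤
α/2` the lazy chain is in `A` at time `tk` with probability at least `α/2` from any start. Repeated
trials bound the hitting time of `A` by a multiple of `t`
(`IsHittingFunction.le_of_distToStationary_le`).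

Upper bound: let `T` bound the hitting times of all sets of measure at least 1/2. Barta's inequality
applied on both sides of a median gives a Poincaré inequality with constant `T`
(`poincare_of_hittingFunctions`). The gap alone would lose a factor depending on the smallest mass
of `π`; a maximal inequality in `L²(π)` avoids this. For `f = 1_A - π(A)` and `s` a large multiple
of `T`, the set `G` on which `|Q^(s+n) f| ≤ 1/8` for all `n ≤ t`, `t` of order `T`, has measure at
least 1/2 (`IsReversible.sum_maximalSq_le`). From any start the chain visits `G` within `t` steps
except with probability 1/8, and conditioning on that visit gives `|Q^(s+t) f| ≤ 1/4` everywhere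
(`exists_distToStationary_le`). -/

theorem enat_toENNReal_eq_tsum (k : ℕ∞) :
    (k : ℝ≥0∞) = ∑' n : ℕ, if (n : ℕ∞) < k then (1 : ℝ≥0∞) else 0 := by
  induction k using ENat.recTopCoe with
  | top => simp
  | coe k =>
    rw [tsum_eq_sum (s := Finset.range k)]
    · rw [Finset.sum_congr rfl (g := fun _ => (1 : ℝ≥0∞))]
      · simp
      · intro n hn
        simp [Finset.mem_range.1 hn]
    · intro n hn
      simpa using hn

theorem lt_hitTime_iff {V : Type*} (A : Set V) (ω : ℕ → V) (n : ℕ) :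
    (n : ℕ∞) < hitTime A ω ↔ ∀ i ≤ n, ω i ∉ A := by
  have h := hittingAfter_le_iff (u := fun (t : ℕ) (ω : ℕ → V) => ω t) (s := A) (n := 0) (i := n)
    (ω := ω)
  rw [← not_le]
  refine (not_congr h).trans ?_
  simp

/-! ### Hitting probabilities under the path measure -/

section HittingLaw

variable {V : Type*} [Fintype V] [DecidableEq V]

/-- `survival M A n x` is the probability that the chain with transition matrix `M` started at `x`
does not visit `A` up to time `n`. -/
noncomputable def survival (M : Matrix V V ℝ) (A : Finset V) : ℕ → V → ℝ
  | 0 => fun x => if x ∈ A then 0 else 1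
  | n + 1 => fun x => if x ∈ A then 0 else (M.mulVec (survival M A n)) x

theorem survival_nonneg {M : Matrix V V ℝ} (hM : M ∈ Matrix.rowStochastic ℝ V) (A : Finset V)
    (n : ℕ) (x : V) : 0 ≤ survival M A n x := by
  induction n generalizing x with
  | zero => unfold survival; split_ifs <;> norm_num
  | succ n ih =>
    unfold survival
    split_ifs
    · exact le_rfl
    · exact Finset.sum_nonneg fun y _ => mul_nonneg (Matrix.nonneg_of_mem_rowStochastic hM) (ih y)

/-- The transition operator killed on `A`, on `ℝ≥0∞`-valued functions. -/
noncomputable def killed (P : Matrix.rowStochastic ℝ V) (A : Finset V) (φ : V → ℝ≥0∞) :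
    V → ℝ≥0∞ :=
  fun x => if x ∈ A then 0 else ∑ y, ENNReal.ofReal ((P : Matrix V V ℝ) x y) * φ y

theorem killed_iterate (P : Matrix.rowStochastic ℝ V) (A : Finset V) (n : ℕ) :
    (killed P A)^[n] (fun x => if x ∈ A then 0 else 1)
      = fun x => ENNReal.ofReal (survival (P : Matrix V V ℝ) A n x) := by
  induction n with
  | zero => funext x; by_cases h : x ∈ A <;> simp [survival, h]
  | succ n ih =>
    rw [Function.iterate_succ_apply', ih]
    funext x
    by_cases h : x ∈ A
    · simp [survival, killed, h]
    · simp only [survival, killed, h, if_false, Matrix.mulVec, dotProduct]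
      rw [ENNReal.ofReal_sum_of_nonneg fun y _ =>
        mul_nonneg (Matrix.nonneg_of_mem_rowStochastic P.2) (survival_nonneg P.2 A n y)]
      exact Finset.sum_congr rfl fun y _ =>
        (ENNReal.ofReal_mul (Matrix.nonneg_of_mem_rowStochastic P.2)).symm

variable [MeasurableSpace V] [DiscreteMeasurableSpace V]

theorem lintegral_stepKernel (P : Matrix.rowStochastic ℝ V) (x : V) (φ : V → ℝ≥0∞) :
    ∫⁻ y, φ y ∂(stepKernel P x) = ∑ y, ENNReal.ofReal ((P : Matrix V V ℝ) x y) * φ y := by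
  have h : stepKernel P x = ∑ y, ENNReal.ofReal ((P : Matrix V V ℝ) x y) • Measure.dirac y := rfl
  rw [h, lintegral_finsetSum_measure]
  simp [lintegral_smul_measure]

instance (P : Matrix.rowStochastic ℝ V) (x : V) : IsProbabilityMeasure (pathLaw P x) := by
  unfold pathLaw
  infer_instance

theorem lintegral_pathLaw_zero (P : Matrix.rowStochastic ℝ V) (x : V) (φ : V → ℝ≥0∞) :
    ∫⁻ ω, φ (ω 0) ∂(pathLaw P x) = φ x := by
  unfold pathLaw Kernel.trajMeasure
  have h : (Measure.dirac x).map
      (MeasurableEquiv.piUnique (fun i : Finset.Iic 0 => (fun _ : ℕ => V) i)).symm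
      = Measure.dirac (fun _ => x) :=
    Measure.map_dirac' (MeasurableEquiv.measurable _) x
  rw [h, Measure.dirac_bind (Kernel.measurable _), Kernel.lintegral_traj₀]
  · simp [Function.updateFinset]
  · exact (Measurable.of_discrete.comp (measurable_pi_apply 0)).aemeasurable

/-- The Markov property at time `n`, tested on products of a function of the history and a function
of the next state. -/
theorem lintegral_pathLaw_succ (P : Matrix.rowStochastic ℝ V) (x : V) (n : ℕ)
    (F : (Finset.Iic n → V) → ℝ≥0∞) (φ : V → ℝ≥0∞) :
    ∫⁻ ω, F (Preorder.frestrictLe n ω) * φ (ω (n + 1)) ∂(pathLaw P x)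
      = ∫⁻ ω, F (Preorder.frestrictLe n ω) *
          ∑ y, ENNReal.ofReal ((P : Matrix V V ℝ) (ω n) y) * φ y ∂(pathLaw P x) := by
  have key := Kernel.map_frestrictLe_trajMeasure_compProd_eq_map_trajMeasure
    (X := fun _ => V) (κ := historyKernel P) (μ₀ := Measure.dirac x) (a := n)
  have hm : Measurable fun p : (Finset.Iic n → V) × V => F p.1 * φ p.2 := by
    have h1 : Measurable F := Measurable.of_discrete
    have h2 : Measurable φ := Measurable.of_discrete
    fun_prop
  have h1 : ∫⁻ p, F p.1 * φ p.2 ∂((pathLaw P x).map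
      (fun ω => (Preorder.frestrictLe (π := fun _ => V) n ω, ω (n + 1))))
      = ∫⁻ ω, F (Preorder.frestrictLe n ω) * φ (ω (n + 1)) ∂(pathLaw P x) :=
    lintegral_map hm (by fun_prop)
  rw [← h1]
  unfold pathLaw
  rw [← key, Measure.lintegral_compProd hm, lintegral_map Measurable.of_discrete (by fun_prop)]
  refine lintegral_congr fun ω => ?_
  refine (lintegral_const_mul (F (Preorder.frestrictLe n ω))
    (Measurable.of_discrete (f := φ))).trans ?_
  exact congrArg (F (Preorder.frestrictLe n ω) * ·) (lintegral_stepKernel P (ω n) φ)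

/-- The Markov property removes the last step, replacing `φ` by `killed P A φ`; hence the induction
generalizes `φ`. Avoidance is imposed only at times before `n`, so that `φ` carries any condition at
time `n`. -/
theorem lintegral_pathLaw_killed (P : Matrix.rowStochastic ℝ V) (A : Finset V) (x : V) (n : ℕ)
    (φ : V → ℝ≥0∞) :
    ∫⁻ ω, (if ∀ i < n, ω i ∉ A then 1 else 0) * φ (ω n) ∂(pathLaw P x)
      = ((killed P A)^[n] φ) x := by
  induction n generalizing φ with
  | zero => simpa using lintegral_pathLaw_zero P x φ
  | succ n ih =>
    rw [Function.iterate_succ_apply, ← ih]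
    have h := lintegral_pathLaw_succ P x n
      (fun p => if ∀ i, p i ∉ A then 1 else 0) φ
    have e : ∀ ω : ℕ → V, (∀ i, Preorder.frestrictLe (π := fun _ => V) n ω i ∉ A)
        ↔ ∀ i < n + 1, ω i ∉ A := fun ω => by
      simp [Preorder.frestrictLe, Finset.restrict]
    simp only [e] at h
    rw [h]
    refine lintegral_congr fun ω => ?_
    by_cases h1 : ∀ i < n, ω i ∉ A
    · by_cases h2 : ω n ∈ A
      · have : ¬ ∀ i < n + 1, ω i ∉ A := fun h => h n (Nat.lt_succ_self n) h2
        rw [if_neg this]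
        simp [killed, h2]
      · have : ∀ i < n + 1, ω i ∉ A := fun i hi => by
          rcases Nat.lt_succ_iff_lt_or_eq.1 hi with hi | rfl
          exacts [h1 i hi, h2]
        rw [if_pos this, if_pos h1]
        simp [killed, h2]
    · have : ¬ ∀ i < n + 1, ω i ∉ A := fun h => h1 fun i hi => h i (hi.trans (Nat.lt_succ_self n))
      rw [if_neg this, if_neg h1]
      simp

theorem expHitTime_eq_tsum (P : Matrix.rowStochastic ℝ V) (x : V) (A : Finset V) :
    expHitTime P x (A : Set V)
      = ∑' n, ENNReal.ofReal (survival (P : Matrix V V ℝ) A n x) := by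
  unfold expHitTime
  have e : ∀ ω : ℕ → V, (hitTime (A : Set V) ω : ℝ≥0∞) = ∑' n : ℕ,
      (if ∀ i < n, ω i ∉ A then 1 else 0) * (if ω n ∈ A then 0 else 1 : ℝ≥0∞) := fun ω => by
    rw [enat_toENNReal_eq_tsum]
    refine tsum_congr fun n => ?_
    have h0 : (n : ℕ∞) < hitTime (A : Set V) ω ↔ (∀ i < n, ω i ∉ A) ∧ ω n ∉ A := by
      rw [lt_hitTime_iff]
      refine ⟨fun h => ⟨fun i hi => h i hi.le, h n le_rfl⟩, fun h i hi => ?_⟩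
      rcases hi.lt_or_eq with hi | rfl
      exacts [h.1 i hi, h.2]
    rw [if_congr h0 rfl rfl]
    by_cases h1 : ∀ i < n, ω i ∉ A <;> by_cases h2 : ω n ∈ A <;> simp only [h1, h2] <;> simp
  simp_rw [e]
  rw [lintegral_tsum]
  · refine tsum_congr fun n => ?_
    rw [lintegral_pathLaw_killed P A x n (fun y => if y ∈ A then 0 else 1), killed_iterate]
  · intro n
    have h1 : Measurable fun p : Finset.Iic n → V =>
        ((if ∀ i : Finset.Iic n, (i : ℕ) < n → p i ∉ A then 1 else 0) *
          (if p ⟨n, Finset.mem_Iic.2 le_rfl⟩ ∈ A then 0 else 1) : ℝ≥0∞) := Measurable.of_discrete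
    have h2 : Measurable (Preorder.frestrictLe (π := fun _ : ℕ => V) n) := by fun_prop
    refine Measurable.aemeasurable ?_
    convert h1.comp h2 using 1
    funext ω
    have h3 : (∀ i : Finset.Iic n, (i : ℕ) < n → ω i ∉ A) ↔ ∀ i < n, ω i ∉ A :=
      ⟨fun h i hi => h ⟨i, Finset.mem_Iic.2 hi.le⟩ hi, fun h i hi => h i hi⟩
    exact congrArg (· * (if ω n ∈ A then 0 else 1 : ℝ≥0∞)) (if_congr h3.symm rfl rfl)

end HittingLaw

/-- An irreducible chain has no proper nonempty closed class. -/
theorem mem_of_isIrreducible {V : Type*} {P : Matrix V V ℝ} (hP : P.IsIrreducible) {S : Set V}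
    {x : V} (hx : x ∈ S) (hS : ∀ x ∈ S, ∀ y, 0 < P x y → y ∈ S) (y : V) : y ∈ S := by
  let := Matrix.toQuiver P
  obtain ⟨p, -⟩ := hP.connected x y
  induction p with
  | nil => exact hx
  | cons p e ih => exact hS _ ih _ e.down

/-! ### Hitting functions: existence, tail bounds, laziness -/

section HittingFunction

variable {V : Type*} [Fintype V] [DecidableEq V]

theorem mulVec_mono {M : Matrix V V ℝ} (hM : M ∈ Matrix.rowStochastic ℝ V) {f g : V → ℝ}
    (h : ∀ x, f x ≤ g x) (x : V) : M.mulVec f x ≤ M.mulVec g x :=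
  Finset.sum_le_sum fun y _ =>
    mul_le_mul_of_nonneg_left (h y) (Matrix.nonneg_of_mem_rowStochastic hM)

theorem mulVec_const {M : Matrix V V ℝ} (hM : M ∈ Matrix.rowStochastic ℝ V) (c : ℝ) (x : V) :
    M.mulVec (fun _ => c) x = c := by
  simp only [Matrix.mulVec, dotProduct]
  rw [← Finset.sum_mul, Matrix.sum_row_of_mem_rowStochastic hM, one_mul]

/-- The maximum principle for functions that are subharmonic off a nonempty set. -/
theorem nonpos_of_le_mulVec {P : Matrix V V ℝ} (hP : P.IsIrreducible)
    (hM : P ∈ Matrix.rowStochastic ℝ V) {A : Finset V} (hA : A.Nonempty) {u : V → ℝ}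
    (hu₀ : ∀ x ∈ A, u x ≤ 0) (hu : ∀ x ∉ A, u x ≤ P.mulVec u x) (x : V) : u x ≤ 0 := by
  obtain ⟨a, ha⟩ := hA
  obtain ⟨m, -, hm⟩ := Finset.exists_max_image Finset.univ u ⟨a, Finset.mem_univ a⟩
  refine (hm x (Finset.mem_univ x)).trans ?_
  by_contra! hpos
  -- Where `u` attains a positive maximum the point lies off `A`, and subharmonicity forces the same
  -- value at every neighbour. The maximisers thus form a closed class, which would contain `a ∈ A`.
  have key := mem_of_isIrreducible hP (S := {x | u x = u m}) (x := m) rfl (fun x hx y hy => ?_) a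
  · have := hu₀ a ha
    rw [Set.mem_ofPred_eq] at key
    linarith
  · rw [Set.mem_ofPred_eq] at hx ⊢
    have hxA : x ∉ A := fun h => by linarith [hu₀ x h]
    have h1 : ∑ z, P x z * (u m - u z) = u m - P.mulVec u x := by
      simp only [mul_sub, Finset.sum_sub_distrib, Matrix.mulVec, dotProduct]
      rw [← Finset.sum_mul, Matrix.sum_row_of_mem_rowStochastic hM, one_mul]
    have h2 : P x y * (u m - u y) ≤ ∑ z, P x z * (u m - u z) :=
      Finset.single_le_sum (f := fun z => P x z * (u m - u z)) (fun z _ =>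
        mul_nonneg (hP.nonneg x z) (sub_nonneg.2 (hm z (Finset.mem_univ z)))) (Finset.mem_univ y)
    have h3 := hu x hxA
    have h4 : P x y * (u m - u y) ≤ 0 := by linarith
    have h5 := hm y (Finset.mem_univ y)
    nlinarith

/-- The equations satisfied by the expected hitting times of `A`. -/
def IsHittingFunction (M : Matrix V V ℝ) (A : Finset V) (h : V → ℝ) : Prop :=
  (∀ x ∈ A, h x = 0) ∧ ∀ x ∉ A, h x = 1 + M.mulVec h x

/-- The equations form a square linear system; the maximum principle applied to `f` and `-f` shows
that its kernel is trivial. -/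
theorem exists_isHittingFunction {P : Matrix V V ℝ} (hP : P.IsIrreducible)
    (hM : P ∈ Matrix.rowStochastic ℝ V) {A : Finset V} (hA : A.Nonempty) :
    ∃ h, IsHittingFunction P A h := by
  let L : (V → ℝ) →ₗ[ℝ] (V → ℝ) :=
    { toFun := fun f x => if x ∈ A then f x else f x - P.mulVec f x
      map_add' := fun f g => by
        funext x
        by_cases hx : x ∈ A
        · simp [hx]
        · simp [hx, Matrix.mulVec_add]; ring
      map_smul' := fun c f => by
        funext x
        by_cases hx : x ∈ A
        · simp [hx]
        · simp [hx, Matrix.mulVec_smul]; ring }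
  have hL : ∀ f x, L f x = if x ∈ A then f x else f x - P.mulVec f x := fun _ _ => rfl
  have hle : ∀ f, L f = 0 → ∀ x, f x ≤ 0 := fun f hf => by
    refine nonpos_of_le_mulVec hP hM hA (fun x hx => ?_) (fun x hx => ?_)
    · have := hL f x
      rw [hf, if_pos hx] at this
      exact this.symm.le
    · have := hL f x
      rw [hf, if_neg hx, Pi.zero_apply] at this
      linarith
  have hinj : Function.Injective L := by
    refine (injective_iff_map_eq_zero L).2 fun f hf => ?_
    funext x
    have h1 := hle f hf x
    have h2 := hle (-f) (by rw [map_neg, hf, neg_zero]) x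
    rw [Pi.neg_apply] at h2
    rw [Pi.zero_apply]
    linarith
  obtain ⟨h, hh⟩ := LinearMap.injective_iff_surjective.1 hinj (fun x => if x ∈ A then 0 else 1)
  refine ⟨h, fun x hx => ?_, fun x hx => ?_⟩
  · have := hL h x
    simp only [hh, if_pos hx] at this
    exact this.symm
  · have := hL h x
    simp only [hh, if_neg hx] at this
    linarith

theorem IsHittingFunction.nonneg {P : Matrix V V ℝ} (hP : P.IsIrreducible)
    (hM : P ∈ Matrix.rowStochastic ℝ V) {A : Finset V} (hA : A.Nonempty) {h : V → ℝ}
    (hh : IsHittingFunction P A h) (x : V) : 0 ≤ h x := by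
  have := nonpos_of_le_mulVec hP hM hA (u := -h) (fun x hx => by simp [hh.1 x hx])
    (fun x hx => by rw [Matrix.mulVec_neg, Pi.neg_apply, Pi.neg_apply, hh.2 x hx]; linarith) x
  simpa using this

theorem survival_of_mem {M : Matrix V V ℝ} {A : Finset V} {x : V} (hx : x ∈ A) (n : ℕ) :
    survival M A n x = 0 := by
  cases n <;> simp [survival, hx]

theorem survival_succ_of_notMem {M : Matrix V V ℝ} {A : Finset V} {x : V} (hx : x ∉ A) (n : ℕ) :
    survival M A (n + 1) x = M.mulVec (survival M A n) x := by
  simp [survival, hx]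

theorem survival_zero_of_notMem {M : Matrix V V ℝ} {A : Finset V} {x : V} (hx : x ∉ A) :
    survival M A 0 x = 1 := by
  simp [survival, hx]

theorem survival_le_one {M : Matrix V V ℝ} (hM : M ∈ Matrix.rowStochastic ℝ V) (A : Finset V)
    (n : ℕ) (x : V) : survival M A n x ≤ 1 := by
  by_cases hx : x ∈ A
  · rw [survival_of_mem hx]; exact zero_le_one
  induction n generalizing x with
  | zero => rw [survival_zero_of_notMem hx]
  | succ n ih =>
    rw [survival_succ_of_notMem hx]
    refine (mulVec_mono hM (g := fun _ => 1) (fun y => ?_) x).trans (mulVec_const hM 1 x).le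
    by_cases hy : y ∈ A
    · rw [survival_of_mem hy]; exact zero_le_one
    · exact ih y hy

theorem survival_antitone {M : Matrix V V ℝ} (hM : M ∈ Matrix.rowStochastic ℝ V) (A : Finset V)
    (x : V) : Antitone fun n => survival M A n x := by
  refine antitone_nat_of_succ_le fun n => ?_
  induction n generalizing x with
  | zero =>
    by_cases hx : x ∈ A
    · rw [survival_of_mem hx, survival_of_mem hx]
    · rw [survival_zero_of_notMem hx]
      exact survival_le_one hM A 1 x
  | succ n ih =>
    by_cases hx : x ∈ A
    · rw [survival_of_mem hx, survival_of_mem hx]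
    · rw [survival_succ_of_notMem hx, survival_succ_of_notMem hx]
      exact mulVec_mono hM ih x

theorem sum_survival_succ {M : Matrix V V ℝ} {A : Finset V} {x : V} (hx : x ∉ A) (n : ℕ) :
    ∑ i ∈ Finset.range (n + 1), survival M A i x
      = 1 + M.mulVec (fun y => ∑ i ∈ Finset.range n, survival M A i y) x := by
  rw [Finset.sum_range_succ', survival_zero_of_notMem hx, add_comm]
  congr 1
  simp only [survival_succ_of_notMem hx, Matrix.mulVec, dotProduct, Finset.mul_sum]
  exact Finset.sum_comm

theorem IsHittingFunction.sum_survival_le {M : Matrix V V ℝ} (hM : M ∈ Matrix.rowStochastic ℝ V)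
    {A : Finset V} {h : V → ℝ} (hh : IsHittingFunction M A h) (h0 : ∀ x, 0 ≤ h x) (n : ℕ) (x : V) :
    ∑ i ∈ Finset.range n, survival M A i x ≤ h x := by
  induction n generalizing x with
  | zero => simpa using h0 x
  | succ n ih =>
    by_cases hx : x ∈ A
    · simp [survival_of_mem hx, h0 x]
    · rw [sum_survival_succ hx, hh.2 x hx]
      exact add_le_add le_rfl (mulVec_mono hM ih x)

/-- The sum is the expectation of the hitting time truncated at `n`; on survival, the expected
remaining time is at most `H`. -/
theorem IsHittingFunction.le_sum_survival {M : Matrix V V ℝ} (hM : M ∈ Matrix.rowStochastic ℝ V)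
    {A : Finset V} {h : V → ℝ} (hh : IsHittingFunction M A h) {H : ℝ} (hH : ∀ x, h x ≤ H)
    (n : ℕ) (x : V) :
    h x ≤ ∑ i ∈ Finset.range n, survival M A i x + H * survival M A n x := by
  by_cases hx : x ∈ A
  · simp [survival_of_mem hx, hh.1 x hx]
  induction n generalizing x with
  | zero => simpa [survival_zero_of_notMem hx] using hH x
  | succ n ih =>
    rw [sum_survival_succ hx, survival_succ_of_notMem hx, hh.2 x hx, add_assoc]
    refine add_le_add le_rfl ?_
    have : M.mulVec (fun y => ∑ i ∈ Finset.range n, survival M A i y) x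
        + H * M.mulVec (survival M A n) x
        = M.mulVec ((fun y => ∑ i ∈ Finset.range n, survival M A i y) + H • survival M A n) x := by
      rw [Matrix.mulVec_add, Matrix.mulVec_smul, Pi.add_apply, Pi.smul_apply, smul_eq_mul]
    rw [this]
    refine mulVec_mono hM (fun y => ?_) x
    by_cases hy : y ∈ A
    · simp [survival_of_mem hy, hh.1 y hy]
    · exact ih y hy

theorem IsHittingFunction.hasSum_survival {M : Matrix V V ℝ} (hM : M ∈ Matrix.rowStochastic ℝ V)
    {A : Finset V} {h : V → ℝ} (hh : IsHittingFunction M A h) (h0 : ∀ x, 0 ≤ h x) (x : V) :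
    HasSum (fun n => survival M A n x) (h x) := by
  have hs : Summable fun n => survival M A n x :=
    summable_of_sum_range_le (fun n => survival_nonneg hM A n x)
      (fun n => hh.sum_survival_le hM h0 n x)
  rw [hasSum_iff_tendsto_nat_of_nonneg fun n => survival_nonneg hM A n x]
  have h1 : Filter.Tendsto (fun n => h x - (∑ y, h y) * survival M A n x) Filter.atTop
      (nhds (h x)) := by
    simpa using (hs.tendsto_atTop_zero.const_mul (∑ y, h y)).const_sub (h x)
  refine tendsto_of_tendsto_of_tendsto_of_le_of_le h1 tendsto_const_nhds (fun n => ?_)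
    (fun n => hh.sum_survival_le hM h0 n x)
  have := hh.le_sum_survival hM (H := ∑ y, h y)
    (fun x => Finset.single_le_sum (fun y _ => h0 y) (Finset.mem_univ x)) n x
  simp only
  linarith

theorem IsHittingFunction.expHitTime_eq [MeasurableSpace V] [DiscreteMeasurableSpace V]
    {P : Matrix.rowStochastic ℝ V} {A : Finset V} {h : V → ℝ}
    (hh : IsHittingFunction (P : Matrix V V ℝ) A h) (h0 : ∀ x, 0 ≤ h x) (x : V) :
    expHitTime P x (A : Set V) = ENNReal.ofReal (h x) := by
  rw [expHitTime_eq_tsum, ← (hh.hasSum_survival P.2 h0 x).tsum_eq,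
    ENNReal.ofReal_tsum_of_nonneg (fun n => survival_nonneg P.2 A n x)
      (hh.hasSum_survival P.2 h0 x).summable]

/-- At a maximiser `m` of `h`, truncation at `s` gives `h m ≤ s + (1 - δ) h m`. -/
theorem IsHittingFunction.le_div_of_survival_le {M : Matrix V V ℝ}
    (hM : M ∈ Matrix.rowStochastic ℝ V) {A : Finset V} {h : V → ℝ} (hh : IsHittingFunction M A h)
    {s : ℕ} {δ : ℝ} (hδ : 0 < δ) (hs : ∀ x, survival M A s x ≤ 1 - δ) (h0 : ∀ x, 0 ≤ h x) (x : V) :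
    h x ≤ s / δ := by
  obtain ⟨m, -, hm⟩ := Finset.exists_max_image Finset.univ h ⟨x, Finset.mem_univ x⟩
  refine (hm x (Finset.mem_univ x)).trans ?_
  have h1 := hh.le_sum_survival hM (fun x => hm x (Finset.mem_univ x)) s m
  have h2 : ∑ i ∈ Finset.range s, survival M A i m ≤ s := by
    simpa using Finset.sum_le_card_nsmul (Finset.range s) (fun i => survival M A i m) 1
      (fun i _ => survival_le_one hM A i m)
  have h3 := mul_le_mul_of_nonneg_left (hs m) (h0 m)
  rw [le_div_iff₀ hδ]
  linarith

/-- Being in `A` at time `n` and not having visited `A` up to time `n` are disjoint events. -/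
theorem survival_add_le_one {M : Matrix V V ℝ} (hM : M ∈ Matrix.rowStochastic ℝ V) (A : Finset V)
    (n : ℕ) (x : V) :
    survival M A n x + (M ^ n).mulVec (fun y => if y ∈ A then 1 else 0) x ≤ 1 := by
  by_cases hx : x ∈ A
  · rw [survival_of_mem hx, zero_add]
    have hMn := pow_mem hM n
    refine (mulVec_mono hMn (g := fun _ => 1) (fun y => ?_) x).trans (mulVec_const hMn 1 x).le
    split_ifs <;> norm_num
  induction n generalizing x with
  | zero => simp [survival, hx]
  | succ n ih =>
    rw [survival_succ_of_notMem hx, pow_succ', ← Matrix.mulVec_mulVec, ← Pi.add_apply,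
      ← Matrix.mulVec_add]
    refine (mulVec_mono hM (g := fun _ => 1) (fun y => ?_) x).trans (mulVec_const hM 1 x).le
    by_cases hy : y ∈ A
    · rw [Pi.add_apply, survival_of_mem hy, zero_add]
      have hMn := pow_mem hM n
      refine (mulVec_mono hMn (g := fun _ => 1) (fun y => ?_) y).trans (mulVec_const hMn 1 y).le
      split_ifs <;> norm_num
    · exact ih y hy

theorem lazyMatrix_mulVec (P : Matrix V V ℝ) (f : V → ℝ) (x : V) :
    (lazyMatrix P).mulVec f x = (P.mulVec f x + f x) / 2 := by
  rw [lazyMatrix, Matrix.smul_mulVec, Matrix.add_mulVec, Matrix.one_mulVec, Pi.smul_apply,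
    Pi.add_apply, smul_eq_mul]
  ring

theorem lazyMatrix_mem {P : Matrix V V ℝ} (hM : P ∈ Matrix.rowStochastic ℝ V) :
    lazyMatrix P ∈ Matrix.rowStochastic ℝ V := by
  have h := Matrix.convex_rowStochastic (R := ℝ) (n := V) hM (one_mem _)
    (a := 1 / 2) (b := 1 / 2) (by norm_num) (by norm_num) (by norm_num)
  rwa [← smul_add] at h

theorem IsHittingFunction.lazy {P : Matrix V V ℝ} {A : Finset V} {h : V → ℝ}
    (hh : IsHittingFunction P A h) : IsHittingFunction (lazyMatrix P) A ((2 : ℝ) • h) := by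
  refine ⟨fun x hx => by simp [hh.1 x hx], fun x hx => ?_⟩
  rw [Matrix.mulVec_smul, Pi.smul_apply, Pi.smul_apply, lazyMatrix_mulVec, smul_eq_mul,
    smul_eq_mul]
  linarith [hh.2 x hx]

end HittingFunction

/-! ### Total variation and the lower bound on the mixing time -/

section Mixing

variable {V : Type*} [Fintype V] [DecidableEq V]

theorem IsStationary.sum_mulVec {M : Matrix V V ℝ} {π : V → ℝ} (hπ : IsStationary M π)
    (f : V → ℝ) : ∑ x, π x * M.mulVec f x = ∑ x, π x * f x := by
  simp only [Matrix.mulVec, dotProduct, Finset.mul_sum]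
  rw [Finset.sum_comm]
  refine Finset.sum_congr rfl fun y _ => ?_
  rw [← hπ.2 y, Finset.sum_mul]
  exact Finset.sum_congr rfl fun x _ => (mul_assoc _ _ _).symm

theorem IsStationary.lazy {P : Matrix V V ℝ} {π : V → ℝ} (hπ : IsStationary P π) :
    IsStationary (lazyMatrix P) π := by
  refine ⟨hπ.1, fun y => ?_⟩
  have h : ∀ x, π x * lazyMatrix P x y = (π x * P x y + π x * (1 : Matrix V V ℝ) x y) / 2 :=
    fun x => by
      rw [lazyMatrix, Matrix.smul_apply, Matrix.add_apply, smul_eq_mul]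
      ring
  simp only [h, ← Finset.sum_div, Finset.sum_add_distrib, hπ.2 y]
  simp [Matrix.one_apply]

theorem IsStationary.pow {M : Matrix V V ℝ} {π : V → ℝ} (hπ : IsStationary M π) (n : ℕ) :
    IsStationary (M ^ n) π := by
  induction n with
  | zero => exact ⟨hπ.1, fun y => by simp [Matrix.one_apply]⟩
  | succ n ih =>
    refine ⟨hπ.1, fun y => ?_⟩
    have h := ih.sum_mulVec (fun x => M x y)
    rw [hπ.2 y] at h
    rw [pow_succ, ← h]
    rfl

theorem tvDist_le_distToStationary (Q : Matrix V V ℝ) (π : V → ℝ) (t : ℕ) (x : V) :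
    tvDist (fun y => (Q ^ t) x y) π ≤ distToStationary Q π t :=
  le_ciSup (f := fun x => tvDist (fun y => (Q ^ t) x y) π) (Set.finite_range _).bddAbove x

/-- Both `M x ·` and `π` have total mass 1, so the constant `b` may be subtracted from `f`. -/
theorem abs_mulVec_sub_le {M : Matrix V V ℝ} (hM : M ∈ Matrix.rowStochastic ℝ V) {π : V → ℝ}
    (hπ : π ∈ stdSimplex ℝ V) {f : V → ℝ} {b c : ℝ} (hf : ∀ y, |f y - b| ≤ c) (x : V) :
    |M.mulVec f x - ∑ y, π y * f y| ≤ 2 * tvDist (fun y => M x y) π * c := by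
  have h : M.mulVec f x - ∑ y, π y * f y = ∑ y, (M x y - π y) * (f y - b) := by
    simp only [sub_mul, mul_sub, Finset.sum_sub_distrib, ← Finset.sum_mul,
      Matrix.sum_row_of_mem_rowStochastic hM, hπ.2, Matrix.mulVec, dotProduct]
    ring
  have h2 : 2 * tvDist (fun y => M x y) π = ∑ y, |M x y - π y| := by
    simp [tvDist]
  rw [h, h2, Finset.sum_mul]
  refine (Finset.abs_sum_le_sum_abs _ _).trans (Finset.sum_le_sum fun y _ => ?_)
  rw [abs_mul]
  exact mul_le_mul_of_nonneg_left (hf y) (abs_nonneg _)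

/-- A chain whose distance to stationarity at time `t` is at most `1 / 4` halves deviations from
the mean every `t` steps. -/
theorem abs_pow_mul_mulVec_sub_le {Q : Matrix V V ℝ} (hQ : Q ∈ Matrix.rowStochastic ℝ V)
    {π : V → ℝ} (hπ : IsStationary Q π) {t : ℕ} (ht : distToStationary Q π t ≤ 1 / 4)
    {f : V → ℝ} (hf : ∀ y, |f y - ∑ z, π z * f z| ≤ 1) (k : ℕ) (x : V) :
    |(Q ^ (t * k)).mulVec f x - ∑ z, π z * f z| ≤ (1 / 2) ^ k := by
  induction k generalizing x with
  | zero => simpa using hf x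
  | succ k ih =>
    -- A further block of `t` steps acts on `Q^(tk) f`, which has the same mean; the contraction
    -- factor is `2 · 1/4`.
    have h := abs_mulVec_sub_le (pow_mem hQ t) hπ.1 ih x
    rw [(hπ.pow (t * k)).sum_mulVec, Matrix.mulVec_mulVec, ← pow_add] at h
    rw [show t * (k + 1) = t + t * k by ring]
    have h2 := (tvDist_le_distToStationary Q π t x).trans ht
    refine h.trans ?_
    have h3 : (0 : ℝ) ≤ (1 / 2) ^ k := by positivity
    rw [pow_succ]
    nlinarith

theorem sum_indicator (π : V → ℝ) (A : Finset V) :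
    ∑ z, π z * (if z ∈ A then 1 else 0) = ∑ z ∈ A, π z := by
  simp

theorem sum_mem_unitInterval {π : V → ℝ} (hπ : π ∈ stdSimplex ℝ V) (A : Finset V) :
    0 ≤ ∑ z ∈ A, π z ∧ ∑ z ∈ A, π z ≤ 1 :=
  ⟨Finset.sum_nonneg fun z _ => hπ.1 z,
    (Finset.sum_le_sum_of_subset_of_nonneg (Finset.subset_univ A) fun z _ _ => hπ.1 z).trans
      hπ.2.le⟩

theorem abs_indicator_sub_le {π : V → ℝ} (hπ : π ∈ stdSimplex ℝ V) (A : Finset V) (y : V) :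
    |(if y ∈ A then (1 : ℝ) else 0) - ∑ z ∈ A, π z| ≤ 1 := by
  obtain ⟨h0, h1⟩ := sum_mem_unitInterval hπ A
  rw [abs_le]
  split_ifs <;> constructor <;> linarith

/-- Hitting times of sets of measure at least `α` are bounded by the lazy mixing time. -/
theorem IsHittingFunction.le_of_distToStationary_le {P : Matrix V V ℝ}
    (hM : P ∈ Matrix.rowStochastic ℝ V) {π : V → ℝ} (hπ : IsStationary P π) {α : ℝ} (hα : 0 < α)
    {A : Finset V} (hA : α ≤ ∑ y ∈ A, π y) {h : V → ℝ} (hh : IsHittingFunction P A h)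
    (h0 : ∀ x, 0 ≤ h x) {k : ℕ} (hk : (1 / 2 : ℝ) ^ k ≤ α / 2) {t : ℕ}
    (ht : distToStationary (lazyMatrix P) π t ≤ 1 / 4) (x : V) : h x ≤ k / α * t := by
  have hQ := lazyMatrix_mem hM
  have hs : ∀ y, survival (lazyMatrix P) A (t * k) y ≤ 1 - α / 2 := fun y => by
    have h1 := survival_add_le_one hQ A (t * k) y
    have h2 := abs_pow_mul_mulVec_sub_le hQ hπ.lazy ht (f := fun y => if y ∈ A then 1 else 0)
      (fun y => by rw [sum_indicator]; exact abs_indicator_sub_le hπ.1 A y) k y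
    rw [sum_indicator] at h2
    linarith [(abs_le.1 h2).1]
  have h3 := hh.lazy.le_div_of_survival_le hQ (half_pos hα) hs
    (fun y => by simpa using h0 y) x
  rw [Pi.smul_apply, smul_eq_mul] at h3
  have h4 : ((t * k : ℕ) : ℝ) / (α / 2) = 2 * (k / α * t) := by
    push_cast
    field_simp
  linarith

/-- For equal total masses the distance is attained on the set where `μ < ν`, so a one-sided bound
suffices. -/
theorem tvDist_le_of_forall_finset {μ ν : V → ℝ} (hμ : ∑ x, μ x = ∑ x, ν x) {ε : ℝ}
    (h : ∀ A : Finset V, ∑ x ∈ A, ν x - ε ≤ ∑ x ∈ A, μ x) : tvDist μ ν ≤ ε := by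
  have h1 := h (Finset.univ.filter fun x => μ x < ν x)
  rw [Finset.sum_filter, Finset.sum_filter] at h1
  have h2 : ∑ x, |μ x - ν x| = ∑ x, μ x - ∑ x, ν x
      + 2 * (∑ x, (if μ x < ν x then ν x else 0) - ∑ x, (if μ x < ν x then μ x else 0)) := by
    rw [← Finset.sum_sub_distrib, ← Finset.sum_sub_distrib, Finset.mul_sum,
      ← Finset.sum_add_distrib]
    refine Finset.sum_congr rfl fun x _ => ?_
    split_ifs with hx
    · rw [abs_of_neg (sub_neg.2 hx)]; ring
    · rw [abs_of_nonneg (by linarith)]; ring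
  rw [tvDist, h2, hμ]
  linarith

theorem distToStationary_le_of_forall_finset {Q : Matrix V V ℝ}
    (hQ : Q ∈ Matrix.rowStochastic ℝ V) {π : V → ℝ} (hπ : π ∈ stdSimplex ℝ V) {n : ℕ} {ε : ℝ}
    (h : ∀ (A : Finset V) (x : V), ∑ z ∈ A, π z - ε
      ≤ (Q ^ n).mulVec (fun y => if y ∈ A then 1 else 0) x) :
    distToStationary Q π n ≤ ε := by
  have : Nonempty V := by
    by_contra hV
    rw [not_nonempty_iff] at hV
    simpa using hπ.2
  refine ciSup_le fun x => tvDist_le_of_forall_finset ?_ fun A => ?_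
  · rw [Matrix.sum_row_of_mem_rowStochastic (pow_mem hQ n), hπ.2]
  · refine (h A x).trans (le_of_eq ?_)
    simp [Matrix.mulVec, dotProduct]

theorem lazyMixingTime_le {P : Matrix V V ℝ} {π : V → ℝ} {n : ℕ}
    (h : distToStationary (lazyMatrix P) π n ≤ 1 / 4) : lazyMixingTime P π ≤ n :=
  iInf₂_le n h

end Mixing

/-! ### Decay of convex nonnegative sequences -/

section ConvexSequence

variable {a : ℕ → ℝ} {R : ℝ}

theorem antitone_of_convex_of_even (hconv : ∀ n, a (n + 1) - a (n + 2) ≤ a n - a (n + 1))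
    (heven : ∀ k, a (2 * k + 1) ≤ a (2 * k)) : Antitone a := by
  refine antitone_nat_of_succ_le fun n => ?_
  rcases Nat.even_or_odd' n with ⟨k, rfl | rfl⟩
  · exact heven k
  · have h1 := hconv (2 * k + 1)
    have h2 : a (2 * k + 1 + 2) ≤ a (2 * k + 1 + 1) := heven (k + 1)
    linarith

/-- The decrements `b n = a n - a (n + 1)` decrease, so the sum is at most the telescoping bound `b
(2s)`. The first `2s + 1` decrements are each at least `b (2s)` and add up to at most `a 0`. -/
theorem sum_second_difference_le (hconv : ∀ n, a (n + 1) - a (n + 2) ≤ a n - a (n + 1))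
    (hanti : Antitone a) (h0 : ∀ n, 0 ≤ a n) (s m : ℕ) :
    ∑ k ∈ Finset.range m, (a (2 * (s + k)) - 2 * a (2 * (s + k) + 1) + a (2 * (s + k) + 2))
      ≤ a 0 / (2 * s + 1) := by
  have h1 : ∑ k ∈ Finset.range m,
      (a (2 * (s + k)) - 2 * a (2 * (s + k) + 1) + a (2 * (s + k) + 2))
      ≤ (a (2 * s) - a (2 * s + 1)) - (a (2 * (s + m)) - a (2 * (s + m) + 1)) := by
    induction m with
    | zero => simp
    | succ m ih =>
      rw [Finset.sum_range_succ]
      have h2 := hconv (2 * (s + m) + 1)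
      rw [show 2 * (s + (m + 1)) = 2 * (s + m) + 1 + 1 by ring]
      rw [show 2 * (s + m) + 1 + 2 = 2 * (s + m) + 1 + 1 + 1 by ring] at h2
      rw [show 2 * (s + m) + 2 = 2 * (s + m) + 1 + 1 by ring]
      linarith
  have h2 : a (2 * (s + m) + 1) ≤ a (2 * (s + m)) := hanti (Nat.le_succ _)
  have hb : Antitone fun n => a n - a (n + 1) := antitone_nat_of_succ_le hconv
  have h3 : (2 * s + 1 : ℕ) • (a (2 * s) - a (2 * s + 1))
      ≤ ∑ i ∈ Finset.range (2 * s + 1), (a i - a (i + 1)) := by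
    have := Finset.card_nsmul_le_sum (Finset.range (2 * s + 1)) (fun i => a i - a (i + 1))
      (a (2 * s) - a (2 * s + 1))
      (fun i hi => hb (Nat.lt_succ_iff.1 (Finset.mem_range.1 hi)))
    simpa only [Finset.card_range] using this
  rw [Finset.sum_range_sub', nsmul_eq_mul] at h3
  push_cast at h3
  have h4 := h0 (2 * s + 1)
  refine h1.trans ?_
  rw [le_div_iff₀ (by positivity)]
  have h5 : (0 : ℝ) < 2 * s + 1 := by positivity
  nlinarith

theorem sum_even_le (hanti : Antitone a) (h0 : ∀ n, 0 ≤ a n) (hR : 0 ≤ R)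
    (hgap : ∀ k, a (2 * k) ≤ R * (a (2 * k) - a (2 * k + 1))) (m : ℕ) :
    ∑ k ∈ Finset.range m, a (2 * k) ≤ R * a 0 := by
  have h : ∑ k ∈ Finset.range m, a (2 * k) ≤ R * (a 0 - a (2 * m)) := by
    induction m with
    | zero => simp
    | succ m ih =>
      rw [Finset.sum_range_succ]
      have h1 : a (2 * m + 2) ≤ a (2 * m + 1) := hanti (Nat.le_succ _)
      have h2 := mul_le_mul_of_nonneg_left h1 hR
      have h3 := hgap m
      rw [show 2 * (m + 1) = 2 * m + 2 by ring]
      linarith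
  have := mul_nonneg hR (h0 (2 * m))
  linarith

end ConvexSequence

/-! ### Reversibility, Dirichlet forms and the Poincaré inequality -/

section L2

variable {V : Type*} [Fintype V] [DecidableEq V]

/-- The bilinear form `∑ₓ π(x) f(x) g(x)`. -/
noncomputable def piForm (π f g : V → ℝ) : ℝ := ∑ x, π x * f x * g x

theorem IsReversible.lazy {P : Matrix V V ℝ} {π : V → ℝ} (hr : IsReversible P π) :
    IsReversible (lazyMatrix P) π := fun x y => by
  have h : π x * (1 : Matrix V V ℝ) x y = π y * (1 : Matrix V V ℝ) y x := by
    by_cases hxy : x = y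
    · subst hxy; rfl
    · rw [Matrix.one_apply_ne hxy, Matrix.one_apply_ne (Ne.symm hxy), mul_zero, mul_zero]
  simp only [lazyMatrix, Matrix.smul_apply, Matrix.add_apply, smul_eq_mul]
  linear_combination (1 / 2) * hr x y + (1 / 2) * h

theorem IsReversible.piForm_mulVec {M : Matrix V V ℝ} {π : V → ℝ} (hr : IsReversible M π)
    (f g : V → ℝ) : piForm π (M.mulVec f) g = piForm π f (M.mulVec g) := by
  simp only [piForm, Matrix.mulVec, dotProduct, Finset.mul_sum, Finset.sum_mul]
  rw [Finset.sum_comm]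
  refine Finset.sum_congr rfl fun x _ => Finset.sum_congr rfl fun y _ => ?_
  linear_combination (f x * g y) * hr y x

theorem IsReversible.piForm_pow {M : Matrix V V ℝ} {π : V → ℝ} (hr : IsReversible M π)
    (f g : V → ℝ) (m n : ℕ) :
    piForm π ((M ^ m).mulVec f) ((M ^ n).mulVec g) = piForm π f ((M ^ (m + n)).mulVec g) := by
  induction m generalizing n with
  | zero => simp
  | succ m ih =>
    rw [pow_succ', ← Matrix.mulVec_mulVec, hr.piForm_mulVec, Matrix.mulVec_mulVec, ← pow_succ',
      ih, show m + (n + 1) = m + 1 + n by ring]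

theorem IsReversible.sum_symm {M : Matrix V V ℝ} {π : V → ℝ} (hr : IsReversible M π)
    (F : V → V → ℝ) : ∑ x, ∑ y, π x * M x y * F x y = ∑ x, ∑ y, π x * M x y * F y x := by
  rw [Finset.sum_comm]
  exact Finset.sum_congr rfl fun x _ => Finset.sum_congr rfl fun y _ => by rw [hr y x]

theorem sum_sum_left {M : Matrix V V ℝ} (hM : M ∈ Matrix.rowStochastic ℝ V) (π f g : V → ℝ) :
    ∑ x, ∑ y, π x * M x y * (f x * g x) = piForm π f g := by
  refine Finset.sum_congr rfl fun x _ => ?_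
  rw [← Finset.sum_mul, ← Finset.mul_sum, Matrix.sum_row_of_mem_rowStochastic hM]
  ring

theorem sum_sum_cross (M : Matrix V V ℝ) (π f g : V → ℝ) :
    ∑ x, ∑ y, π x * M x y * (f x * g y) = piForm π f (M.mulVec g) := by
  simp only [piForm, Matrix.mulVec, dotProduct, Finset.mul_sum]
  exact Finset.sum_congr rfl fun x _ => Finset.sum_congr rfl fun y _ => by ring

/-- The Dirichlet form as a sum over edges. -/
theorem IsReversible.sum_sub_mul_sub {M : Matrix V V ℝ} (hM : M ∈ Matrix.rowStochastic ℝ V)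
    {π : V → ℝ} (hr : IsReversible M π) (f g : V → ℝ) :
    ∑ x, ∑ y, π x * M x y * ((f x - f y) * (g x - g y))
      = 2 * (piForm π f g - piForm π f (M.mulVec g)) := by
  have h1 := hr.sum_symm fun x y => f x * g x
  have h2 := hr.sum_symm fun x y => f x * g y
  rw [sum_sum_left hM] at h1
  rw [sum_sum_cross] at h2
  have h3 : ∑ x, ∑ y, π x * M x y * ((f x - f y) * (g x - g y))
      = ∑ x, ∑ y, π x * M x y * (f x * g x) - ∑ x, ∑ y, π x * M x y * (f x * g y)
        - ∑ x, ∑ y, π x * M x y * (f y * g x) + ∑ x, ∑ y, π x * M x y * (f y * g y) := by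
    simp only [← Finset.sum_sub_distrib, ← Finset.sum_add_distrib]
    exact Finset.sum_congr rfl fun x _ => Finset.sum_congr rfl fun y _ => by ring
  rw [h3, ← h1, ← h2, sum_sum_left hM, sum_sum_cross]
  ring

theorem IsReversible.sum_add_sq {M : Matrix V V ℝ} (hM : M ∈ Matrix.rowStochastic ℝ V)
    {π : V → ℝ} (hr : IsReversible M π) (f : V → ℝ) :
    ∑ x, ∑ y, π x * M x y * (f x + f y) ^ 2
      = 2 * (piForm π f f + piForm π f (M.mulVec f)) := by
  have h1 := hr.sum_symm fun x y => f x * f x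
  have h2 := hr.sum_symm fun x y => f x * f y
  rw [sum_sum_left hM] at h1
  rw [sum_sum_cross] at h2
  have h3 : ∑ x, ∑ y, π x * M x y * (f x + f y) ^ 2
      = ∑ x, ∑ y, π x * M x y * (f x * f x) + ∑ x, ∑ y, π x * M x y * (f x * f y)
        + ∑ x, ∑ y, π x * M x y * (f y * f x) + ∑ x, ∑ y, π x * M x y * (f y * f y) := by
    simp only [← Finset.sum_add_distrib]
    exact Finset.sum_congr rfl fun x _ => Finset.sum_congr rfl fun y _ => by ring
  rw [h3, ← h1, ← h2, sum_sum_left hM, sum_sum_cross]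
  ring

theorem piForm_self_nonneg {π : V → ℝ} (hπ : π ∈ stdSimplex ℝ V) (f : V → ℝ) :
    0 ≤ piForm π f f :=
  Finset.sum_nonneg fun x _ => by
    rw [mul_assoc]
    exact mul_nonneg (hπ.1 x) (mul_self_nonneg _)

theorem piForm_lazyMatrix (P : Matrix V V ℝ) (π f g : V → ℝ) :
    piForm π f ((lazyMatrix P).mulVec g) = (piForm π f (P.mulVec g) + piForm π f g) / 2 := by
  simp only [piForm, lazyMatrix_mulVec, ← Finset.sum_add_distrib, Finset.sum_div]
  exact Finset.sum_congr rfl fun x _ => by ring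

theorem IsReversible.piForm_lazyMatrix_nonneg {P : Matrix V V ℝ}
    (hM : P ∈ Matrix.rowStochastic ℝ V) {π : V → ℝ} (hπ : π ∈ stdSimplex ℝ V)
    (hr : IsReversible P π) (f : V → ℝ) : 0 ≤ piForm π f ((lazyMatrix P).mulVec f) := by
  have h : 0 ≤ ∑ x, ∑ y, π x * P x y * (f x + f y) ^ 2 :=
    Finset.sum_nonneg fun x _ => Finset.sum_nonneg fun y _ =>
      mul_nonneg (mul_nonneg (hπ.1 x) (Matrix.nonneg_of_mem_rowStochastic hM)) (sq_nonneg _)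
  rw [hr.sum_add_sq hM] at h
  rw [piForm_lazyMatrix]
  linarith

/-- Barta's inequality: a function vanishing on `A` has a spectral gap of at least the inverse of
the maximal expected hitting time of `A`. -/
theorem IsHittingFunction.piForm_le {P : Matrix V V ℝ} (hM : P ∈ Matrix.rowStochastic ℝ V)
    {π : V → ℝ} (hπ : π ∈ stdSimplex ℝ V) (hr : IsReversible P π) {A : Finset V} {h : V → ℝ}
    (hh : IsHittingFunction P A h) (h0 : ∀ x, 0 ≤ h x) {T : ℝ} (hT : ∀ x, h x ≤ T) (hT0 : 0 ≤ T)
    {g : V → ℝ} (hg : ∀ x ∈ A, g x = 0) :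
    2 * piForm π g g ≤ T * ∑ x, ∑ y, π x * P x y * (g x - g y) ^ 2 := by
  have hpos : ∀ x ∉ A, 0 < h x := fun x hx => by
    have : 0 ≤ P.mulVec h x :=
      Finset.sum_nonneg fun y _ => mul_nonneg (Matrix.nonneg_of_mem_rowStochastic hM) (h0 y)
    linarith [hh.2 x hx]
  -- Testing `h` against `g² / h` turns `(I - P) h = 1` off `A` into the sum of `π g² / h`, which is
  -- at least `piForm π g g / T`.
  have h1 := hr.sum_sub_mul_sub hM (fun x => g x ^ 2 / h x) h
  have h2 : piForm π (fun x => g x ^ 2 / h x) h - piForm π (fun x => g x ^ 2 / h x) (P.mulVec h)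
      = ∑ x, π x * (g x ^ 2 / h x) := by
    rw [piForm, piForm, ← Finset.sum_sub_distrib]
    refine Finset.sum_congr rfl fun x _ => ?_
    by_cases hx : x ∈ A
    · simp [hg x hx]
    · linear_combination (π x * (g x ^ 2 / h x)) * hh.2 x hx
  have h3 : piForm π g g ≤ T * ∑ x, π x * (g x ^ 2 / h x) := by
    rw [piForm, Finset.mul_sum]
    refine Finset.sum_le_sum fun x _ => ?_
    by_cases hx : x ∈ A
    · simp [hg x hx]
    · have h4 : g x ^ 2 ≤ T * (g x ^ 2 / h x) := by
        rw [← mul_div_assoc, le_div_iff₀ (hpos x hx), mul_comm]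
        exact mul_le_mul_of_nonneg_right (hT x) (sq_nonneg _)
      have h5 := mul_le_mul_of_nonneg_left h4 (hπ.1 x)
      linarith
  have h4 : ∑ x, ∑ y, π x * P x y * ((g x ^ 2 / h x - g y ^ 2 / h y) * (h x - h y))
      ≤ ∑ x, ∑ y, π x * P x y * (g x - g y) ^ 2 := by
    refine Finset.sum_le_sum fun x _ => Finset.sum_le_sum fun y _ => mul_le_mul_of_nonneg_left ?_
      (mul_nonneg (hπ.1 x) (Matrix.nonneg_of_mem_rowStochastic hM))
    -- On `A` the quotient `g² / h` is `0 / 0 = 0`, so edges meeting `A` give equality. Off `A` the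
    -- difference of the two sides is a square over `h x * h y` (Picone's identity).
    by_cases hx : x ∈ A <;> by_cases hy : y ∈ A
    · simp [hg x hx, hg y hy]
    · have := (hpos y hy).ne'
      rw [hg x hx, hh.1 x hx]
      apply le_of_eq
      field_simp
      ring
    · have := (hpos x hx).ne'
      rw [hg y hy, hh.1 y hy]
      apply le_of_eq
      field_simp
      ring
    · have hx' := hpos x hx
      have hy' := hpos y hy
      have h5 : (g x - g y) ^ 2 - (g x ^ 2 / h x - g y ^ 2 / h y) * (h x - h y)
          = (g x * h y - g y * h x) ^ 2 / (h x * h y) := by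
        field_simp
        ring
      have h6 : 0 ≤ (g x * h y - g y * h x) ^ 2 / (h x * h y) := by positivity
      linarith
  have h5 := mul_le_mul_of_nonneg_left h4 hT0
  rw [h1, h2] at h5
  linarith

theorem exists_median {π : V → ℝ} (hπ : π ∈ stdSimplex ℝ V) (f : V → ℝ) :
    ∃ m, 1 / 2 ≤ ∑ x with f x ≤ m, π x ∧ 1 / 2 ≤ ∑ x with m ≤ f x, π x := by
  have hV : (Finset.univ : Finset V).Nonempty := by
    by_contra hV
    rw [Finset.not_nonempty_iff_eq_empty] at hV
    have := hπ.2
    rw [hV, Finset.sum_empty] at this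
    exact zero_ne_one this
  obtain ⟨z, -, hz⟩ := Finset.exists_max_image Finset.univ f hV
  -- The median is the least value of `f` whose lower level set has mass at least 1/2. If its upper
  -- level set had mass below 1/2, the next smaller value would qualify too.
  let S := Finset.univ.filter fun x => 1 / 2 ≤ ∑ y with f y ≤ f x, π y
  have hS : S.Nonempty := ⟨z, by
    rw [Finset.mem_filter, Finset.filter_true_of_mem hz, hπ.2]
    exact ⟨Finset.mem_univ z, by norm_num⟩⟩
  obtain ⟨m, hm, hmin⟩ := Finset.exists_min_image S f hS
  refine ⟨f m, (Finset.mem_filter.1 hm).2, ?_⟩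
  by_contra! hlt
  have h1 := Finset.sum_filter_add_sum_filter_not Finset.univ (fun x => f m ≤ f x) π
  rw [hπ.2] at h1
  have hne : (Finset.univ.filter fun x => ¬ f m ≤ f x).Nonempty := by
    by_contra h
    rw [Finset.not_nonempty_iff_eq_empty] at h
    rw [h, Finset.sum_empty] at h1
    linarith
  obtain ⟨w, hw, hwmax⟩ := Finset.exists_max_image _ f hne
  have hwlt := not_le.1 (Finset.mem_filter.1 hw).2
  refine hwlt.not_ge (hmin w (Finset.mem_filter.2 ⟨Finset.mem_univ w, ?_⟩))
  have h2 : ∑ x with ¬ f m ≤ f x, π x ≤ ∑ y with f y ≤ f w, π y :=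
    Finset.sum_le_sum_of_subset_of_nonneg
      (fun x hx => Finset.mem_filter.2 ⟨Finset.mem_univ x, hwmax x hx⟩) fun x _ _ => hπ.1 x
  linarith

/-- The Poincaré inequality with constant the maximal expected hitting time of sets of measure at
least one half. -/
theorem poincare_of_hittingFunctions {P : Matrix V V ℝ} (hM : P ∈ Matrix.rowStochastic ℝ V)
    {π : V → ℝ} (hπ : π ∈ stdSimplex ℝ V) (hr : IsReversible P π) {T : ℝ} (hT0 : 0 ≤ T)
    (hT : ∀ A : Finset V, 1 / 2 ≤ ∑ y ∈ A, π y →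
      ∃ h, IsHittingFunction P A h ∧ ∀ x, 0 ≤ h x ∧ h x ≤ T)
    {f : V → ℝ} (hf : ∑ x, π x * f x = 0) :
    piForm π f f ≤ T * (piForm π f f - piForm π f (P.mulVec f)) := by
  obtain ⟨m, hm1, hm2⟩ := exists_median hπ f
  obtain ⟨h₁, hh₁, hb₁⟩ := hT _ hm1
  obtain ⟨h₂, hh₂, hb₂⟩ := hT _ hm2
  -- The positive and negative parts of `f - m` each vanish on a set of measure at least 1/2.
  have e₁ := hh₁.piForm_le hM hπ hr (fun x => (hb₁ x).1) (fun x => (hb₁ x).2) hT0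
    (g := fun x => max (f x - m) 0)
    (fun x hx => max_eq_right (sub_nonpos.2 (Finset.mem_filter.1 hx).2))
  have e₂ := hh₂.piForm_le hM hπ hr (fun x => (hb₂ x).1) (fun x => (hb₂ x).2) hT0
    (g := fun x => max (m - f x) 0)
    (fun x hx => max_eq_right (sub_nonpos.2 (Finset.mem_filter.1 hx).2))
  have e₃ : piForm π f f ≤ piForm π (fun x => max (f x - m) 0) (fun x => max (f x - m) 0)
      + piForm π (fun x => max (m - f x) 0) (fun x => max (m - f x) 0) := by
    have h1 : piForm π (fun x => max (f x - m) 0) (fun x => max (f x - m) 0)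
      + piForm π (fun x => max (m - f x) 0) (fun x => max (m - f x) 0)
      = piForm π f f - 2 * m * ∑ x, π x * f x + m ^ 2 * ∑ x, π x := by
      simp only [piForm, Finset.mul_sum, ← Finset.sum_sub_distrib, ← Finset.sum_add_distrib]
      refine Finset.sum_congr rfl fun x _ => ?_
      rcases le_total (f x) m with h | h
      · rw [max_eq_right (sub_nonpos.2 h), max_eq_left (sub_nonneg.2 h)]; ring
      · rw [max_eq_left (sub_nonneg.2 h), max_eq_right (sub_nonpos.2 h)]; ring
    rw [h1, hf, hπ.2]
    nlinarith [sq_nonneg m]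
  have e₄ : ∑ x, ∑ y, π x * P x y * (max (f x - m) 0 - max (f y - m) 0) ^ 2
      + ∑ x, ∑ y, π x * P x y * (max (m - f x) 0 - max (m - f y) 0) ^ 2
      ≤ ∑ x, ∑ y, π x * P x y * ((f x - f y) * (f x - f y)) := by
    simp only [← Finset.sum_add_distrib, ← mul_add]
    refine Finset.sum_le_sum fun x _ => Finset.sum_le_sum fun y _ => mul_le_mul_of_nonneg_left ?_
      (mul_nonneg (hπ.1 x) (Matrix.nonneg_of_mem_rowStochastic hM))
    rcases le_total (f x) m with h | h <;> rcases le_total (f y) m with h' | h'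
    · rw [max_eq_right (sub_nonpos.2 h), max_eq_left (sub_nonneg.2 h),
        max_eq_right (sub_nonpos.2 h'), max_eq_left (sub_nonneg.2 h')]
      apply le_of_eq
      ring
    · rw [max_eq_right (sub_nonpos.2 h), max_eq_left (sub_nonneg.2 h),
        max_eq_left (sub_nonneg.2 h'), max_eq_right (sub_nonpos.2 h')]
      nlinarith [mul_nonneg (sub_nonneg.2 h) (sub_nonneg.2 h')]
    · rw [max_eq_left (sub_nonneg.2 h), max_eq_right (sub_nonpos.2 h),
        max_eq_right (sub_nonpos.2 h'), max_eq_left (sub_nonneg.2 h')]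
      nlinarith [mul_nonneg (sub_nonneg.2 h) (sub_nonneg.2 h')]
    · rw [max_eq_left (sub_nonneg.2 h), max_eq_right (sub_nonpos.2 h),
        max_eq_left (sub_nonneg.2 h'), max_eq_right (sub_nonpos.2 h')]
      apply le_of_eq
      ring
  have e₅ := mul_le_mul_of_nonneg_left e₄ hT0
  rw [hr.sum_sub_mul_sub hM] at e₅
  linarith

end L2

/-! ### Maximal inequality and the upper bound on the mixing time -/

section MaximalFunction

variable {V : Type*} [Fintype V] [DecidableEq V]

theorem piForm_sub_self (π u v : V → ℝ) :
    piForm π (u - v) (u - v) = piForm π u u - 2 * piForm π u v + piForm π v v := by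
  simp only [piForm, Finset.mul_sum, ← Finset.sum_sub_distrib, ← Finset.sum_add_distrib,
    Pi.sub_apply]
  exact Finset.sum_congr rfl fun x _ => by ring

theorem piForm_add_self (π u v : V → ℝ) :
    piForm π (u + v) (u + v) = piForm π u u + 2 * piForm π u v + piForm π v v := by
  simp only [piForm, Finset.mul_sum, ← Finset.sum_add_distrib, Pi.add_apply]
  exact Finset.sum_congr rfl fun x _ => by ring

theorem piForm_sub_sub (π u v u' v' : V → ℝ) :
    piForm π (u - v) (u' - v')
      = piForm π u u' - piForm π u v' - piForm π v u' + piForm π v v' := by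
  simp only [piForm, ← Finset.sum_sub_distrib, ← Finset.sum_add_distrib, Pi.sub_apply]
  exact Finset.sum_congr rfl fun x _ => by ring

/-- Self-adjointness splits the power evenly; for odd `n` one factor `Q` remains, and laziness makes
it positive semidefinite. -/
theorem IsReversible.autocorrelation_nonneg {P : Matrix V V ℝ}
    (hM : P ∈ Matrix.rowStochastic ℝ V) {π : V → ℝ} (hπ : π ∈ stdSimplex ℝ V)
    (hr : IsReversible P π) (f : V → ℝ) (n : ℕ) :
    0 ≤ piForm π f ((lazyMatrix P ^ n).mulVec f) := by
  rcases Nat.even_or_odd' n with ⟨k, rfl | rfl⟩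
  · rw [two_mul, ← hr.lazy.piForm_pow]
    exact piForm_self_nonneg hπ _
  · rw [show 2 * k + 1 = k + (k + 1) by ring, ← hr.lazy.piForm_pow, pow_succ',
      ← Matrix.mulVec_mulVec]
    exact hr.piForm_lazyMatrix_nonneg hM hπ _

/-- The second difference is the autocorrelation of `f - Q f`, nonnegative for the same reason. -/
theorem IsReversible.autocorrelation_convex {P : Matrix V V ℝ}
    (hM : P ∈ Matrix.rowStochastic ℝ V) {π : V → ℝ} (hπ : π ∈ stdSimplex ℝ V)
    (hr : IsReversible P π) (f : V → ℝ) (n : ℕ) :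
    piForm π f ((lazyMatrix P ^ (n + 1)).mulVec f) - piForm π f ((lazyMatrix P ^ (n + 2)).mulVec f)
      ≤ piForm π f ((lazyMatrix P ^ n).mulVec f)
        - piForm π f ((lazyMatrix P ^ (n + 1)).mulVec f) := by
  rcases Nat.even_or_odd' n with ⟨k, rfl | rfl⟩
  · have h := piForm_self_nonneg hπ
      ((lazyMatrix P ^ k).mulVec f - (lazyMatrix P ^ (k + 1)).mulVec f)
    simp only [piForm_sub_self, hr.lazy.piForm_pow] at h
    rw [show k + k = 2 * k by ring, show k + (k + 1) = 2 * k + 1 by ring,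
      show k + 1 + (k + 1) = 2 * k + 2 by ring] at h
    linarith
  · have h := hr.piForm_lazyMatrix_nonneg hM hπ
      ((lazyMatrix P ^ k).mulVec f - (lazyMatrix P ^ (k + 1)).mulVec f)
    simp only [Matrix.mulVec_sub, Matrix.mulVec_mulVec, ← pow_succ', piForm_sub_sub,
      hr.lazy.piForm_pow] at h
    rw [show k + (k + 1) = 2 * k + 1 by ring, show k + (k + 1 + 1) = 2 * k + 1 + 1 by ring,
      show k + 1 + (k + 1) = 2 * k + 1 + 1 by ring,
      show k + 1 + (k + 1 + 1) = 2 * k + 1 + 2 by ring] at h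
    linarith

/-- A maximal function dominating `(Qⁿ f)²` for `s ≤ n ≤ s + t`. -/
noncomputable def maximalSq (Q : Matrix V V ℝ) (f : V → ℝ) (s t : ℕ) (x : V) : ℝ :=
  (Q ^ (s + t)).mulVec f x ^ 2 + ∑ k ∈ Finset.range t,
    |(Q ^ (s + k)).mulVec f x ^ 2 - (Q ^ (s + k + 1)).mulVec f x ^ 2|

theorem maximalSq_nonneg (Q : Matrix V V ℝ) (f : V → ℝ) (s t : ℕ) (x : V) :
    0 ≤ maximalSq Q f s t x :=
  add_nonneg (sq_nonneg _) (Finset.sum_nonneg fun _ _ => abs_nonneg _)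

theorem sq_le_maximalSq (Q : Matrix V V ℝ) (f : V → ℝ) (s : ℕ) {t n : ℕ} (hn : n ≤ t) (x : V) :
    (Q ^ (s + n)).mulVec f x ^ 2 ≤ maximalSq Q f s t x := by
  induction t, hn using Nat.le_induction with
  | base =>
    exact le_add_of_nonneg_right (Finset.sum_nonneg fun _ _ => abs_nonneg _)
  | succ t _ ih =>
    refine ih.trans ?_
    rw [maximalSq, maximalSq, Finset.sum_range_succ, ← add_assoc s t 1]
    linarith [le_abs_self ((Q ^ (s + t)).mulVec f x ^ 2 - (Q ^ (s + t + 1)).mulVec f x ^ 2)]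

/-- Factor `u² - v² = (u - v)(u + v)` for consecutive iterates `u`, `v`. The sum of `(u - v)²` is a
sum of second differences of the autocorrelation, of order `1/s`; the sum of `(u + v)²` is of order
`R` by the gap. Their weighted combination is small once `s` is a large multiple of `R`, uniformly
in `t`. -/
theorem IsReversible.sum_maximalSq_le {P : Matrix V V ℝ} (hM : P ∈ Matrix.rowStochastic ℝ V)
    {π : V → ℝ} (hπ : IsStationary P π) (hr : IsReversible P π) {R : ℝ} (hR : 0 < R)
    (hgap : ∀ f : V → ℝ, ∑ x, π x * f x = 0 →
      piForm π f f ≤ R * (piForm π f f - piForm π f ((lazyMatrix P).mulVec f)))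
    {f : V → ℝ} (hf : ∑ x, π x * f x = 0) (hf1 : piForm π f f ≤ 1) {s : ℕ} (hs : 65536 * R ≤ s)
    (t : ℕ) : ∑ x, π x * maximalSq (lazyMatrix P) f s t x ≤ 1 / 128 := by
  set Q := lazyMatrix P with hQ
  set a : ℕ → ℝ := fun n => piForm π f ((Q ^ n).mulVec f) with ha
  have hmul : ∀ m n, piForm π ((Q ^ m).mulVec f) ((Q ^ n).mulVec f) = a (m + n) :=
    fun m n => hr.lazy.piForm_pow f f m n
  have h0 : ∀ n, 0 ≤ a n := hr.autocorrelation_nonneg hM hπ.1 f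
  have hconv : ∀ n, a (n + 1) - a (n + 2) ≤ a n - a (n + 1) :=
    hr.autocorrelation_convex hM hπ.1 f
  have hg : ∀ k, a (2 * k) ≤ R * (a (2 * k) - a (2 * k + 1)) := fun k => by
    have h := hgap ((Q ^ k).mulVec f) (by rw [(hπ.lazy.pow k).sum_mulVec, hf])
    rw [Matrix.mulVec_mulVec, ← pow_succ', hmul, hmul] at h
    rwa [show k + k = 2 * k by ring, show k + (k + 1) = 2 * k + 1 by ring] at h
  have hanti : Antitone a := antitone_of_convex_of_even hconv fun k => by
    have h1 := h0 (2 * k)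
    by_contra! hlt
    nlinarith [hg k]
  have ha0 : a 0 ≤ 1 := by simpa [ha] using hf1
  have hs0 : (0 : ℝ) < s := lt_of_lt_of_le (by positivity) hs
  have hsum := sum_even_le hanti h0 hR.le hg
  have hRa : R * a 0 ≤ R := by nlinarith
  -- This term is at most each of the `s` earlier even terms, whose sum is at most `R`.
  have e1 : a (2 * (s + t)) ≤ 1 / 65536 := by
    have h1 := Finset.card_nsmul_le_sum (Finset.range s) (fun k => a (2 * k)) (a (2 * (s + t)))
      (fun k hk => hanti (by have := Finset.mem_range.1 hk; omega))
    rw [Finset.card_range, nsmul_eq_mul] at h1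
    have h2 := hsum s
    have h3 := mul_le_mul_of_nonneg_right hs (h0 (2 * (s + t)))
    have h4 : R * (65536 * a (2 * (s + t))) ≤ R * 1 := by linarith
    have h5 := le_of_mul_le_mul_left h4 hR
    linarith
  have e2 : ∑ k ∈ Finset.range t,
      (a (2 * (s + k)) - 2 * a (2 * (s + k) + 1) + a (2 * (s + k) + 2)) ≤ 1 / (131072 * R) := by
    refine (sum_second_difference_le hconv hanti h0 s t).trans ?_
    refine div_le_div₀ zero_le_one ha0 (by positivity) ?_
    linarith
  have e3 : ∑ k ∈ Finset.range t,
      (a (2 * (s + k)) + 2 * a (2 * (s + k) + 1) + a (2 * (s + k) + 2)) ≤ 4 * R := by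
    have h1 : ∑ k ∈ Finset.range t,
        (a (2 * (s + k)) + 2 * a (2 * (s + k) + 1) + a (2 * (s + k) + 2))
        ≤ ∑ k ∈ Finset.range t, 4 * a (2 * (s + k)) := Finset.sum_le_sum fun k _ => by
      have h1 : a (2 * (s + k) + 1) ≤ a (2 * (s + k)) := hanti (by omega)
      have h2 : a (2 * (s + k) + 2) ≤ a (2 * (s + k)) := hanti (by omega)
      linarith
    rw [← Finset.mul_sum] at h1
    have h2 := hsum (s + t)
    rw [Finset.sum_range_add] at h2
    have h3 : 0 ≤ ∑ k ∈ Finset.range s, a (2 * k) := Finset.sum_nonneg fun k _ => h0 _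
    linarith
  have e4 : ∀ k, ∑ x, π x * |(Q ^ (s + k)).mulVec f x ^ 2 - (Q ^ (s + k + 1)).mulVec f x ^ 2|
      ≤ 256 * R * (a (2 * (s + k)) - 2 * a (2 * (s + k) + 1) + a (2 * (s + k) + 2))
        + 1 / (1024 * R) *
          (a (2 * (s + k)) + 2 * a (2 * (s + k) + 1) + a (2 * (s + k) + 2)) := fun k => by
    have h1 := piForm_sub_self π ((Q ^ (s + k)).mulVec f) ((Q ^ (s + k + 1)).mulVec f)
    have h2 := piForm_add_self π ((Q ^ (s + k)).mulVec f) ((Q ^ (s + k + 1)).mulVec f)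
    simp only [hmul] at h1 h2
    rw [show s + k + (s + k) = 2 * (s + k) by ring,
      show s + k + (s + k + 1) = 2 * (s + k) + 1 by ring,
      show s + k + 1 + (s + k + 1) = 2 * (s + k) + 2 by ring] at h1 h2
    rw [← h1, ← h2, piForm, piForm, Finset.mul_sum, Finset.mul_sum, ← Finset.sum_add_distrib]
    refine Finset.sum_le_sum fun x _ => ?_
    set u := (Q ^ (s + k)).mulVec f x with hu
    set v := (Q ^ (s + k + 1)).mulVec f x with hv
    rw [Pi.sub_apply, Pi.add_apply, ← hu, ← hv]
    -- AM-GM, with weights chosen so that the two sums contribute 1/512 and 1/256.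
    have h3 : |u ^ 2 - v ^ 2| ≤ 256 * R * (u - v) ^ 2 + 1 / (1024 * R) * (u + v) ^ 2 := by
      have h4 : 256 * R * (u - v) ^ 2 + 1 / (1024 * R) * (u + v) ^ 2 - (u ^ 2 - v ^ 2)
          = (512 * R * (u - v) - (u + v)) ^ 2 / (1024 * R) := by
        field_simp
        ring
      have h5 : 256 * R * (u - v) ^ 2 + 1 / (1024 * R) * (u + v) ^ 2 + (u ^ 2 - v ^ 2)
          = (512 * R * (u - v) + (u + v)) ^ 2 / (1024 * R) := by
        field_simp
        ring
      have h6 : 0 ≤ (512 * R * (u - v) - (u + v)) ^ 2 / (1024 * R) := by positivity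
      have h7 : 0 ≤ (512 * R * (u - v) + (u + v)) ^ 2 / (1024 * R) := by positivity
      rw [abs_le]
      constructor <;> linarith
    have h4 := mul_le_mul_of_nonneg_left h3 (hπ.1.1 x)
    linarith
  have e5 : ∑ x, π x * maximalSq Q f s t x = a (2 * (s + t)) + ∑ k ∈ Finset.range t,
      ∑ x, π x * |(Q ^ (s + k)).mulVec f x ^ 2 - (Q ^ (s + k + 1)).mulVec f x ^ 2| := by
    rw [Finset.sum_comm, show 2 * (s + t) = (s + t) + (s + t) by ring, ← hmul, piForm,
      ← Finset.sum_add_distrib]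
    refine Finset.sum_congr rfl fun x _ => ?_
    rw [maximalSq, mul_add, Finset.mul_sum]
    ring
  have e6 := Finset.sum_le_sum fun k (_ : k ∈ Finset.range t) => e4 k
  rw [Finset.sum_add_distrib, ← Finset.mul_sum, ← Finset.mul_sum] at e6
  have e7 := mul_le_mul_of_nonneg_left e2 (show 0 ≤ 256 * R by positivity)
  have e8 := mul_le_mul_of_nonneg_left e3 (show 0 ≤ 1 / (1024 * R) by positivity)
  have e9 : 256 * R * (1 / (131072 * R)) = 1 / 512 := by field_simp; norm_num
  have e10 : 1 / (1024 * R) * (4 * R) = 1 / 256 := by field_simp; norm_num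
  rw [e5]
  linarith

theorem half_le_sum_of_sum_le {π : V → ℝ} (hπ : π ∈ stdSimplex ℝ V) {F : V → ℝ}
    (hF : ∀ x, 0 ≤ F x) {c : ℝ} (hc : 0 < c) (h : ∑ x, π x * F x ≤ c / 2) :
    1 / 2 ≤ ∑ x with F x ≤ c, π x := by
  have h1 := Finset.sum_filter_add_sum_filter_not Finset.univ (fun x => F x ≤ c) π
  rw [hπ.2] at h1
  have h2 : c * ∑ x with ¬ F x ≤ c, π x ≤ ∑ x, π x * F x := by
    rw [Finset.mul_sum]
    refine le_trans (Finset.sum_le_sum fun x hx => ?_) (Finset.sum_le_sum_of_subset_of_nonneg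
      (Finset.filter_subset (fun x => ¬ F x ≤ c) _) fun x _ _ => mul_nonneg (hπ.1 x) (hF x))
    rw [mul_comm]
    exact mul_le_mul_of_nonneg_left (not_le.1 (Finset.mem_filter.1 hx).2).le (hπ.1 x)
  have h3 : c * ∑ x with ¬ F x ≤ c, π x ≤ c * (1 / 2) := by linarith
  linarith [le_of_mul_le_mul_left h3 hc]

theorem abs_mulVec_le {M : Matrix V V ℝ} (hM : M ∈ Matrix.rowStochastic ℝ V) {f g : V → ℝ}
    (h : ∀ x, |f x| ≤ g x) (x : V) : |M.mulVec f x| ≤ M.mulVec g x := by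
  refine (Finset.abs_sum_le_sum_abs _ _).trans (Finset.sum_le_sum fun y _ => ?_)
  rw [abs_mul, abs_of_nonneg (Matrix.nonneg_of_mem_rowStochastic hM)]
  exact mul_le_mul_of_nonneg_left (h y) (Matrix.nonneg_of_mem_rowStochastic hM)

/-- If `|Q^(s+n) f| ≤ c` on `G` for all `n ≤ t`, then `|Q^(s+n) f|` exceeds `c` by at most the
probability of not having visited `G`. -/
theorem abs_pow_mulVec_le_add_survival {Q : Matrix V V ℝ} (hQ : Q ∈ Matrix.rowStochastic ℝ V)
    {f : V → ℝ} (hf : ∀ x, |f x| ≤ 1) {G : Finset V} {s t : ℕ} {c : ℝ} (hc : 0 ≤ c)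
    (hG : ∀ x ∈ G, ∀ n ≤ t, |(Q ^ (s + n)).mulVec f x| ≤ c) {n : ℕ} (hn : n ≤ t) (x : V) :
    |(Q ^ (s + n)).mulVec f x| ≤ c + survival Q G n x := by
  by_cases hx : x ∈ G
  · rw [survival_of_mem hx, add_zero]
    exact hG x hx n hn
  induction n generalizing x with
  | zero =>
    rw [survival_zero_of_notMem hx]
    have hQs := pow_mem hQ (s + 0)
    linarith [(abs_mulVec_le hQs hf x).trans (mulVec_const hQs 1 x).le]
  | succ n ih =>
    rw [survival_succ_of_notMem hx, ← add_assoc, pow_succ', ← Matrix.mulVec_mulVec]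
    have h1 : ∀ y, |(Q ^ (s + n)).mulVec f y| ≤ ((fun _ => c) + survival Q G n : V → ℝ) y := by
      intro y
      by_cases hy : y ∈ G
      · rw [Pi.add_apply, survival_of_mem hy, add_zero]
        exact hG y hy n (Nat.le_of_succ_le hn)
      · exact ih (Nat.le_of_succ_le hn) y hy
    refine (abs_mulVec_le hQ h1 x).trans (le_of_eq ?_)
    rw [Matrix.mulVec_add, Pi.add_apply, mulVec_const hQ]

theorem IsHittingFunction.survival_mul_le {M : Matrix V V ℝ} (hM : M ∈ Matrix.rowStochastic ℝ V)
    {A : Finset V} {h : V → ℝ} (hh : IsHittingFunction M A h) (h0 : ∀ x, 0 ≤ h x) (n : ℕ) (x : V) :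
    n * survival M A n x ≤ h x := by
  refine le_trans ?_ (hh.sum_survival_le hM h0 n x)
  have := Finset.card_nsmul_le_sum (Finset.range n) (fun i => survival M A i x)
    (survival M A n x) (fun i hi => survival_antitone hM A x (Finset.mem_range.1 hi).le)
  simpa using this

/-- The lazy mixing time is bounded by the hitting times of sets of measure at least one half. -/
theorem exists_distToStationary_le {P : Matrix V V ℝ} (hM : P ∈ Matrix.rowStochastic ℝ V)
    {π : V → ℝ} (hπ : IsStationary P π) (hr : IsReversible P π) {T : ℝ} (hT1 : 1 ≤ T)
    (hT : ∀ A : Finset V, 1 / 2 ≤ ∑ y ∈ A, π y →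
      ∃ h, IsHittingFunction P A h ∧ ∀ x, 0 ≤ h x ∧ h x ≤ T) :
    ∃ n : ℕ, (n : ℝ) ≤ 131090 * T ∧ distToStationary (lazyMatrix P) π n ≤ 1 / 4 := by
  have hQ := lazyMatrix_mem hM
  -- The lazy gap constant is `R = 2T`, and lazy hitting times are at most `2T`, so survival for
  -- `16T` steps has probability at most 1/8. The two ceilings cost at most `2 ≤ 2T`, whence `131090
  -- = 131072 + 16 + 2`.
  have hs := Nat.le_ceil (65536 * (2 * T))
  have ht := Nat.le_ceil (16 * T)
  have hs' := Nat.ceil_lt_add_one (show 0 ≤ 65536 * (2 * T) by positivity)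
  have ht' := Nat.ceil_lt_add_one (show 0 ≤ 16 * T by positivity)
  set s := ⌈65536 * (2 * T)⌉₊
  set t := ⌈16 * T⌉₊
  refine ⟨s + t, by push_cast; linarith,
    distToStationary_le_of_forall_finset hQ hπ.1 fun A x => ?_⟩
  have hgap : ∀ f : V → ℝ, ∑ x, π x * f x = 0 →
      piForm π f f ≤ (2 * T) * (piForm π f f - piForm π f ((lazyMatrix P).mulVec f)) :=
    fun f hf => by
      have := poincare_of_hittingFunctions hM hπ.1 hr (by linarith) hT hf
      rw [piForm_lazyMatrix]
      linarith
  set p := ∑ z ∈ A, π z with hp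
  let f : V → ℝ := (fun y => if y ∈ A then 1 else 0) - fun _ => p
  have hf1 : ∀ y, |f y| ≤ 1 := abs_indicator_sub_le hπ.1 A
  have hf0 : ∑ y, π y * f y = 0 := by
    simp only [f, Pi.sub_apply, mul_sub, Finset.sum_sub_distrib]
    rw [sum_indicator, ← Finset.sum_mul, hπ.1.2, one_mul, sub_self]
  have hff : piForm π f f ≤ 1 := by
    rw [← hπ.1.2]
    refine Finset.sum_le_sum fun y _ => ?_
    rw [mul_assoc]
    have h1 : f y * f y ≤ 1 := by
      rw [← abs_mul_abs_self]
      exact mul_le_one₀ (hf1 y) (abs_nonneg _) (hf1 y)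
    exact mul_le_of_le_one_right (hπ.1.1 y) h1
  have hmax := hr.sum_maximalSq_le hM hπ (by positivity) hgap hf0 hff hs t
  -- Markov's inequality with threshold `1/64 = (1/8)²`, twice the bound on the mean.
  have hG := half_le_sum_of_sum_le hπ.1 (maximalSq_nonneg (lazyMatrix P) f s t)
    (c := 1 / 64) (by norm_num) (by linarith)
  set G := Finset.univ.filter fun y => maximalSq (lazyMatrix P) f s t y ≤ 1 / 64
  obtain ⟨h, hh, hb⟩ := hT G hG
  have h1 := abs_pow_mulVec_le_add_survival hQ hf1 (G := G) (s := s) (t := t) (c := 1 / 8)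
    (by norm_num) (fun y hy n hn => abs_le_of_sq_le_sq
      (((sq_le_maximalSq _ f s hn y).trans (Finset.mem_filter.1 hy).2).trans (by norm_num))
      (by norm_num)) le_rfl x
  have h2 := hh.lazy.survival_mul_le hQ (fun y => by simpa using (hb y).1) t x
  rw [Pi.smul_apply, smul_eq_mul] at h2
  have h3 : survival (lazyMatrix P) G t x ≤ 1 / 8 := by
    have h4 := mul_le_mul_of_nonneg_right ht (survival_nonneg hQ G t x)
    have h5 : T * (16 * survival (lazyMatrix P) G t x) ≤ T * 2 := by linarith [(hb x).2]
    linarith [le_of_mul_le_mul_left h5 (by linarith)]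
  have h4 : (lazyMatrix P ^ (s + t)).mulVec f x
      = (lazyMatrix P ^ (s + t)).mulVec (fun y => if y ∈ A then 1 else 0) x - p := by
    rw [Matrix.mulVec_sub, Pi.sub_apply, mulVec_const (pow_mem hQ _)]
  rw [h4] at h1
  linarith [(abs_le.1 h1).1]

/-- With a single state hitting times vanish and cannot absorb the rounding in
`exists_distToStationary_le`, so this case is separate. -/
theorem lazyMixingTime_eq_zero_of_subsingleton [Subsingleton V] {P : Matrix V V ℝ}
    (hM : P ∈ Matrix.rowStochastic ℝ V) {π : V → ℝ} (hπ : π ∈ stdSimplex ℝ V) :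
    lazyMixingTime P π = 0 := by
  refine le_antisymm ?_ (zero_le)
  have h : distToStationary (lazyMatrix P) π 0 ≤ 1 / 4 := by
    refine distToStationary_le_of_forall_finset (lazyMatrix_mem hM) hπ fun A x => ?_
    rw [pow_zero, Matrix.one_mulVec]
    by_cases hx : x ∈ A
    · rw [if_pos hx]
      linarith [(sum_mem_unitInterval hπ A).2]
    · have : A = ∅ := Finset.eq_empty_of_forall_notMem fun y hy => hx (Subsingleton.elim y x ▸ hy)
      simp [this]
  simpa using lazyMixingTime_le h

/-- Some state has mass at most 1/2; from it, hitting its complement takes at least one step. -/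
theorem one_le_of_hittingFunctions [Nontrivial V] {P : Matrix V V ℝ}
    (hM : P ∈ Matrix.rowStochastic ℝ V) {π : V → ℝ} (hπ : π ∈ stdSimplex ℝ V) {T : ℝ}
    (hT : ∀ A : Finset V, 1 / 2 ≤ ∑ y ∈ A, π y →
      ∃ h, IsHittingFunction P A h ∧ ∀ x, 0 ≤ h x ∧ h x ≤ T) : 1 ≤ T := by
  obtain ⟨x, y, hxy⟩ := exists_pair_ne V
  have h1 : π x + π y ≤ 1 := by
    rw [← Finset.sum_pair hxy]
    exact (sum_mem_unitInterval hπ _).2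
  obtain ⟨z, hz⟩ : ∃ z, π z ≤ 1 / 2 := by
    by_contra! h
    linarith [h x, h y]
  have h2 := Finset.sum_erase_add Finset.univ π (Finset.mem_univ z)
  rw [hπ.2] at h2
  obtain ⟨h, hh, hb⟩ := hT (Finset.univ.erase z) (by linarith)
  have h3 := hh.2 z (Finset.notMem_erase z _)
  have h4 : 0 ≤ P.mulVec h z := Finset.sum_nonneg fun y _ =>
    mul_nonneg (Matrix.nonneg_of_mem_rowStochastic hM) (hb y).1
  linarith [(hb z).2]

end MaximalFunction

/-! ### Transfer to `maxHitTime` and `lazyMixingTime` -/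

section MaxHitTime

variable {V : Type*} [Fintype V] [DecidableEq V]

theorem nonempty_of_pos_sum {π : V → ℝ} {α : ℝ} (hα : 0 < α) {A : Finset V}
    (hA : α ≤ ∑ y ∈ A, π y) : A.Nonempty := by
  by_contra h
  rw [Finset.not_nonempty_iff_eq_empty] at h
  rw [h, Finset.sum_empty] at hA
  exact hα.not_ge hA

variable [MeasurableSpace V] [DiscreteMeasurableSpace V]

theorem expHitTime_le_maxHitTime (P : Matrix.rowStochastic ℝ V) (π : V → ℝ) {α : ℝ} (x : V)
    {A : Finset V} (hA : α ≤ ∑ y ∈ A, π y) :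
    expHitTime P x (A : Set V) ≤ maxHitTime P π α :=
  le_iSup_of_le x (le_iSup₂_of_le A hA le_rfl)

theorem maxHitTime_lt_top {P : Matrix.rowStochastic ℝ V} (hP : (P : Matrix V V ℝ).IsIrreducible)
    (π : V → ℝ) {α : ℝ} (hα : 0 < α) : maxHitTime P π α < ∞ := by
  -- The supremum over finitely many pairs is dominated by the sum over all of them. The empty set,
  -- never hit, is left out since its mass is below `α`.
  refine lt_of_le_of_lt (b := ∑ x : V, ∑ A : Finset V,
    if A.Nonempty then expHitTime P x (A : Set V) else 0) ?_ ?_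
  · refine iSup_le fun x => iSup₂_le fun A hA => ?_
    refine le_trans ?_ (Finset.single_le_sum (f := fun x => ∑ A : Finset V,
      if A.Nonempty then expHitTime P x (A : Set V) else 0) (fun _ _ => zero_le)
      (Finset.mem_univ x))
    refine le_trans ?_ (Finset.single_le_sum (f := fun A : Finset V =>
      if A.Nonempty then expHitTime P x (A : Set V) else 0) (fun _ _ => zero_le)
      (Finset.mem_univ A))
    rw [if_pos (nonempty_of_pos_sum hα hA)]
  · refine ENNReal.sum_lt_top.2 fun x _ => ENNReal.sum_lt_top.2 fun A _ => ?_
    split_ifs with hA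
    · obtain ⟨h, hh⟩ := exists_isHittingFunction hP P.2 hA
      rw [hh.expHitTime_eq (hh.nonneg hP P.2 hA)]
      exact ENNReal.ofReal_lt_top
    · exact ENNReal.zero_lt_top

theorem maxHitTime_le {P : Matrix.rowStochastic ℝ V} (hP : (P : Matrix V V ℝ).IsIrreducible)
    {π : V → ℝ} {α : ℝ} (hα : 0 < α) {c : ℝ}
    (hc : ∀ (A : Finset V) (h : V → ℝ), α ≤ ∑ y ∈ A, π y →
      IsHittingFunction (P : Matrix V V ℝ) A h → (∀ x, 0 ≤ h x) → ∀ x, h x ≤ c) :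
    maxHitTime P π α ≤ ENNReal.ofReal c := by
  refine iSup_le fun x => iSup₂_le fun A hA => ?_
  have hne := nonempty_of_pos_sum hα hA
  obtain ⟨h, hh⟩ := exists_isHittingFunction hP P.2 hne
  have h0 := hh.nonneg hP P.2 hne
  rw [hh.expHitTime_eq h0]
  exact ENNReal.ofReal_le_ofReal (hc A h hA hh h0 x)

theorem exists_isHittingFunction_le_maxHitTime {P : Matrix.rowStochastic ℝ V}
    (hP : (P : Matrix V V ℝ).IsIrreducible) {π : V → ℝ} {α : ℝ} (hα : 0 < α) {A : Finset V}
    (hA : α ≤ ∑ y ∈ A, π y) :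
    ∃ h, IsHittingFunction (P : Matrix V V ℝ) A h ∧
      ∀ x, 0 ≤ h x ∧ h x ≤ (maxHitTime P π α).toReal := by
  have hne := nonempty_of_pos_sum hα hA
  obtain ⟨h, hh⟩ := exists_isHittingFunction hP P.2 hne
  have h0 := hh.nonneg hP P.2 hne
  refine ⟨h, hh, fun x => ⟨h0 x, ?_⟩⟩
  have h1 := expHitTime_le_maxHitTime P π x hA
  rw [hh.expHitTime_eq h0] at h1
  exact (ENNReal.ofReal_le_iff_le_toReal (maxHitTime_lt_top hP π hα).ne).1 h1

theorem lazyMixingTime_le_mul_maxHitTime {P : Matrix.rowStochastic ℝ V}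
    (hP : (P : Matrix V V ℝ).IsIrreducible) {π : V → ℝ}
    (hπ : IsStationary (P : Matrix V V ℝ) π) (hr : IsReversible (P : Matrix V V ℝ) π) {α : ℝ}
    (hα₀ : 0 < α) (hα : α ≤ 1 / 2) :
    lazyMixingTime (P : Matrix V V ℝ) π ≤ (131090 : ℝ≥0) * maxHitTime P π α := by
  rcases subsingleton_or_nontrivial V with hV | hV
  · rw [lazyMixingTime_eq_zero_of_subsingleton P.2 hπ.1]
    exact zero_le
  have hT : ∀ A : Finset V, 1 / 2 ≤ ∑ y ∈ A, π y → ∃ h, IsHittingFunction (P : Matrix V V ℝ) A h ∧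
      ∀ x, 0 ≤ h x ∧ h x ≤ (maxHitTime P π α).toReal :=
    fun A hA => exists_isHittingFunction_le_maxHitTime hP hα₀ (hα.trans hA)
  have hT1 := one_le_of_hittingFunctions P.2 hπ.1 hT
  obtain ⟨n, hn, hd⟩ := exists_distToStationary_le P.2 hπ hr hT1 hT
  refine (lazyMixingTime_le hd).trans ?_
  rw [← ENNReal.ofReal_toReal (maxHitTime_lt_top hP π hα₀).ne, ← ENNReal.ofReal_coe_nnreal,
    ← ENNReal.ofReal_mul (NNReal.coe_nonneg _), ← ENNReal.ofReal_natCast]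
  exact ENNReal.ofReal_le_ofReal hn

theorem mul_maxHitTime_le_lazyMixingTime {P : Matrix.rowStochastic ℝ V}
    (hP : (P : Matrix V V ℝ).IsIrreducible) {π : V → ℝ}
    (hπ : IsStationary (P : Matrix V V ℝ) π) {α : ℝ} (hα : 0 < α) {k : ℕ}
    (hk : (1 / 2 : ℝ) ^ k ≤ α / 2) {c : ℝ≥0} (hc : (c : ℝ) * k ≤ α) :
    c * maxHitTime P π α ≤ lazyMixingTime (P : Matrix V V ℝ) π := by
  refine le_iInf₂ fun t ht => ?_
  have h := maxHitTime_le hP (π := π) hα (c := k / α * t) fun A h hA hh h0 x =>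
    hh.le_of_distToStationary_le P.2 hπ hα hA h0 hk ht x
  refine (mul_le_mul_right h _).trans ?_
  rw [← ENNReal.ofReal_coe_nnreal, ← ENNReal.ofReal_mul (NNReal.coe_nonneg _),
    ← ENNReal.ofReal_natCast]
  refine ENNReal.ofReal_le_ofReal ?_
  have h1 : (c : ℝ) * (k / α) ≤ 1 := by
    rw [← mul_div_assoc, div_le_one hα]
    exact hc
  rw [← mul_assoc]
  exact mul_le_of_le_one_left (Nat.cast_nonneg t) h1

end MaxHitTime

end ReversibleMixing

theorem mainTheorem1 (α : ℝ) (hα₀ : 0 < α) (hα : α < 1 / 2) :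
    ∃ c' c : ℝ≥0, 0 < c' ∧ 0 < c ∧
      ∀ (V : Type*) [Fintype V] [DecidableEq V] [MeasurableSpace V] [DiscreteMeasurableSpace V]
        (P : Matrix.rowStochastic ℝ V) (π : V → ℝ),
        (P : Matrix V V ℝ).IsIrreducible →
        ReversibleMixing.IsStationary (P : Matrix V V ℝ) π →
        ReversibleMixing.IsReversible (P : Matrix V V ℝ) π →
        ReversibleMixing.maxHitTime P π α < ∞ ∧
        ReversibleMixing.lazyMixingTime (P : Matrix V V ℝ) π < ∞ ∧
        (c' : ℝ≥0∞) * ReversibleMixing.maxHitTime P π α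
          ≤ ReversibleMixing.lazyMixingTime (P : Matrix V V ℝ) π ∧
        ReversibleMixing.lazyMixingTime (P : Matrix V V ℝ) π
          ≤ (c : ℝ≥0∞) * ReversibleMixing.maxHitTime P π α := by
  obtain ⟨k, hk⟩ := exists_pow_lt_of_lt_one (half_pos hα₀) (by norm_num : (1 / 2 : ℝ) < 1)
  -- The lower bound needs `c' k ≤ α`; the denominator `k + 1` is positive without knowing that `k`
  -- is.
  refine ⟨(α / (k + 1)).toNNReal, 131090, ?_, by norm_num, ?_⟩
  · exact Real.toNNReal_pos.2 (div_pos hα₀ (by positivity))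
  intro V _ _ _ _ P π hP hπ hr
  have hfin := ReversibleMixing.maxHitTime_lt_top hP π hα₀
  have hup := ReversibleMixing.lazyMixingTime_le_mul_maxHitTime hP hπ hr hα₀ hα.le
  refine ⟨hfin, hup.trans_lt (ENNReal.mul_lt_top ENNReal.coe_lt_top hfin),
    ReversibleMixing.mul_maxHitTime_le_lazyMixingTime hP hπ hα₀ hk.le ?_, hup⟩
  rw [Real.coe_toNNReal _ (by positivity), div_mul_eq_mul_div, div_le_iff₀ (by positivity)]
  linarith
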